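/- **Model.** Let $p>0$, $0\le a<b$, and let $f:\mathbb R\to\mathbb R$ be strictly positive on $[a,b]$. Let $(X_i,R_i)_{i\ge1}$ be i.i.d. pairs of real random variables with $X_i$ independent of $R_i$, where $X_i$ has Lebesgue density $f_X$ and $R_i$ has the Matsuoka distribution $M(p)$, i.e. the density $2\sqrt{-p^3\ln(r)/\pi}\;r^{p-1}$ on $(0,1)$. Put $Y_i=f(X_i)R_i$, $Z_i=-\ln Y_i$ and $g(x)=\frac{3}{2p}-\ln f(x)$. **Assumptions.** A1. $f_X$ vanishes outside $[a,b]$, is bounded, and is bounded away from $0$ on $[a,b]$. A2. $K:\mathbb R\to\mathbb R$ is symmetric, $u^iK(u)$ is bounded for $i\in\{0,1,2\}$, and $u^jK(u)$ is integrable for $j\in\{0,1,2,4\}$. In addition, for some $\kappa<\infty$ and $0<L<\infty$, either (i) $K(u)=0$ for $|u|>L$ and $|K(u)-K(u')|\le\kappa|u-u'|$ for all $u,u'$; or (ii) $K$ is differentiable, $|K'(u)|\le\kappa$ for all $u$, and for some $v>1$, $|K'(u)|\le\kappa|u|^{-v}$ for $|u|>L$. A2$'$ (non-degeneracy of the local linear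 fit). The $2\times2$ moment matrix $\big(\int_S u^{i+j}K(u)\,du\big)_{i,j\in\{0,1\}}$ is invertible for $S=\mathbb R$ and for $S=[-c,\infty)$, for every $c\ge0$. (This holds automatically if $K\ge0$ and $\int K>0$.) A3. For some $s>2$, $\mathbb E|Z|^s<\infty$ and $\sup_{x\ge0}\mathbb E(|Z|^s\mid X=x)f_X(x)<\infty$ for a version of the conditional expectation, where $(X,Z)=(X_1,Z_1)$. A4. $f_X$ and $f_Xg$ are twice differentiable on $[a,b]$ (one-sidedly at the end points), with uniformly continuous and bounded second derivatives. A5. The bandwidths $h=h_n>0$ satisfy $h\to0$ and $\ln(n)/(nh)\to0$ as $n\to\infty$. **Estimators.** From $(X_i,Z_i)_{i\le n}$, let $\hat g(x)=(1,0)\,(A_x^\top D_xA_x)^{-1}A_x^\top D_x(Z_1,\dots,Z_n)^\top$ be the local linear estimator, where $A_x$ is the $n\times2$ matrix with rows $(1,X_i-x)$ and $D_x=\mathrm{diag}\big(\tfrac1hK(\tfrac{X_i-x}{h})\big)_{i\le n}$ (with $\hat g(x)=0$ where the inverse does not exist). Let $\hat\epsilon_i=Z_i-\hat g(X_i)$,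 $\hat p=\sqrt{3n/(2\sum_{i=1}^n\hat\epsilon_i^2)}$ and $\hat f(x)=\exp\{\frac{3}{2\hat p}-\hat g(x)\}$. **Theorem.** Under A1, A2, A2$'$ and A3–A5, as $n\to\infty$, $$\hat p-p=O_p\Big(h^2+\sqrt{\tfrac{\ln n}{nh}}\Big)\qquad\text{and}\qquad \sup_{x\in[a,b]}\big|\hat f(x)-f(x)\big|=O_p\Big(h^2+\sqrt{\tfrac{\ln n}{nh}}\Big).$$ -/

import Mathlib

open MeasureTheory ProbabilityTheory Filter Topology
open scoped ENNReal

namespace Frontier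

/-- Density of the Matsuoka distribution `M(p)`:
`f_p(x) = 2 √(-p³ ln x / π) x^(p-1)` for `x ∈ (0,1)`, and `0` elsewhere. -/
noncomputable def matsuokaDensity (p : ℝ) : ℝ → ℝ :=
  (Set.Ioo (0 : ℝ) 1).indicator fun x =>
    2 * Real.sqrt (-(p ^ 3) * Real.log x / Real.pi) * x ^ (p - 1)

/-- The Matsuoka distribution `M(p)` on `ℝ`. -/
noncomputable def matsuoka (p : ℝ) : Measure ℝ :=
  volume.withDensity fun x => ENNReal.ofReal (matsuokaDensity p x)

/-- The regression function `g = 3/(2p) - ln f` of the log-linearized model. -/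
noncomputable def regression (p : ℝ) (f : ℝ → ℝ) (x : ℝ) : ℝ :=
  3 / (2 * p) - Real.log (f x)

/-- A random sample `(Y_i, X_i)` from the deterministic frontier model `Y_i = f(X_i) R_i`:
the pairs `(X_i, R_i)` are independent over `i`, `X_i` is independent of `R_i`, `X_i` has Lebesgue
density `fX`, and the efficiency `R_i` has the Matsuoka distribution `M(p)`. -/
structure IsFrontierSample {Ω : Type*} [MeasurableSpace Ω] (μ : Measure Ω)
    (p : ℝ) (f fX : ℝ → ℝ) (X R Y : ℕ → Ω → ℝ) : Prop where
  measurable_X : ∀ i, Measurable (X i)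
  measurable_R : ∀ i, Measurable (R i)
  measurable_density : Measurable fX
  density_nonneg : ∀ x, 0 ≤ fX x
  indep_units : iIndepFun (fun i ω => (X i ω, R i ω)) μ
  indep_input_efficiency : ∀ i, IndepFun (X i) (R i) μ
  law_X : ∀ i, μ.map (X i) = volume.withDensity fun x => ENNReal.ofReal (fX x)
  law_R : ∀ i, μ.map (R i) = matsuoka p
  model : ∀ i ω, Y i ω = f (X i ω) * R i ω

/-- A1: the (nonnegative) input is supported on `[a,b]`, `a < b`, with density bounded above and
bounded away from zero on `[a,b]`. -/
structure AssumptionA1 (a b : ℝ) (fX : ℝ → ℝ) : Prop where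
  nonneg_left : 0 ≤ a
  lt : a < b
  support : ∀ x, x ∉ Set.Icc a b → fX x = 0
  lower : ∃ c, 0 < c ∧ ∀ x ∈ Set.Icc a b, c ≤ fX x
  upper : ∃ C, ∀ x ∈ Set.Icc a b, fX x ≤ C

/-- A2: symmetry, boundedness, integrability and regularity of the kernel. -/
structure AssumptionA2 (K : ℝ → ℝ) : Prop where
  symmetric : ∀ u, K (-u) = K u
  bounded : ∀ i ∈ ({0, 1, 2} : Set ℕ), ∃ C, ∀ u, |u ^ i * K u| ≤ C
  integrable : ∀ j ∈ ({0, 1, 2, 4} : Set ℕ), Integrable fun u : ℝ => u ^ j * K u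
  regular : ∃ κ L : ℝ, 0 < L ∧
    (((∀ u, L < |u| → K u = 0) ∧ ∀ u u', |K u - K u'| ≤ κ * |u - u'|) ∨
      (Differentiable ℝ K ∧ (∀ u, |deriv K u| ≤ κ) ∧
        ∃ v : ℝ, 1 < v ∧ ∀ u, L < |u| → |deriv K u| ≤ κ * |u| ^ (-v)))

/-- The `2 × 2` matrix of the kernel moments `∫_S u^(i+j) K(u) du`, `i, j ∈ {0,1}`. -/
noncomputable def kernelMomentMatrix (K : ℝ → ℝ) (S : Set ℝ) : Matrix (Fin 2) (Fin 2) ℝ :=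
  Matrix.of fun i j => ∫ u in S, u ^ ((i : ℕ) + (j : ℕ)) * K u

/-- The local linear fit with kernel `K` is asymptotically well posed at interior points (full
kernel moments) and at points at distance `c h` from an end of the support (truncated kernel
moments). It holds for every nonnegative symmetric kernel with nonzero integral. -/
structure KernelNondegenerate (K : ℝ → ℝ) : Prop where
  interior : (kernelMomentMatrix K Set.univ).det ≠ 0
  boundary : ∀ c : ℝ, 0 ≤ c → (kernelMomentMatrix K (Set.Ici (-c))).det ≠ 0

/-- A3: for some `s > 2`, `E|Z|^s < ∞`, and `E(|Z|^s | X = x) fX(x)` (for some version `m` of the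
conditional expectation) is bounded over `x ≥ 0`. -/
def AssumptionA3 {Ω : Type*} [MeasurableSpace Ω] (μ : Measure Ω) (fX : ℝ → ℝ)
    (X Z : Ω → ℝ) : Prop :=
  ∃ s : ℝ, 2 < s ∧ Integrable (fun ω => |Z ω| ^ s) μ ∧
    ∃ m : ℝ → ℝ, Measurable m ∧
      (μ[fun ω => |Z ω| ^ s | MeasurableSpace.comap X inferInstance]) =ᵐ[μ] (fun ω => m (X ω)) ∧
      ∃ C, ∀ x, 0 ≤ x → m x * fX x ≤ C

/-- `F` is twice differentiable on `[a,b]` (one-sidedly at the ends) and its second derivative is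
uniformly continuous and bounded there. -/
structure HasRegularSecondDeriv (a b : ℝ) (F : ℝ → ℝ) : Prop where
  diff : DifferentiableOn ℝ F (Set.Icc a b)
  diff_deriv : DifferentiableOn ℝ (derivWithin F (Set.Icc a b)) (Set.Icc a b)
  uniform : UniformContinuousOn
    (derivWithin (derivWithin F (Set.Icc a b)) (Set.Icc a b)) (Set.Icc a b)
  bounded : ∃ C, ∀ x ∈ Set.Icc a b,
    |derivWithin (derivWithin F (Set.Icc a b)) (Set.Icc a b) x| ≤ C

/-- A4: the second derivatives of `fX` and `fX g` are uniformly continuous and bounded on the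
support `[a,b]`. -/
structure AssumptionA4 (a b : ℝ) (fX g : ℝ → ℝ) : Prop where
  density : HasRegularSecondDeriv a b fX
  product : HasRegularSecondDeriv a b fun x => fX x * g x

/-- A5: the bandwidths `h n > 0` satisfy `h → 0` and `ln n / (n h) → 0`. -/
structure AssumptionA5 (h : ℕ → ℝ) : Prop where
  pos : ∀ n, 0 < h n
  tendsto : Tendsto h atTop (𝓝 0)
  rate : Tendsto (fun n : ℕ => Real.log n / (n * h n)) atTop (𝓝 0)

/-- The design matrix `A_z` with rows `(1, x_i - z)`. -/
def designMatrix {n : ℕ} (x : Fin n → ℝ) (z : ℝ) : Matrix (Fin n) (Fin 2) ℝ :=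
  Matrix.of fun i => ![1, x i - z]

/-- The weight matrix `D_z = diag(K_h(x_i - z))`, with `K_h(u) = K(u/h)/h`. -/
noncomputable def weightMatrix {n : ℕ} (K : ℝ → ℝ) (h : ℝ) (x : Fin n → ℝ) (z : ℝ) :
    Matrix (Fin n) (Fin n) ℝ :=
  Matrix.diagonal fun i => 1 / h * K ((x i - z) / h)

/-- The local linear estimator `ĝ(z) = e₁ᵀ (A_zᵀ D_z A_z)⁻¹ A_zᵀ D_z y` from the data
`(x_i, y_i)`, `i < n`. (Where `A_zᵀ D_z A_z` is singular, the value is `0`.) -/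
noncomputable def localLinear {n : ℕ} (K : ℝ → ℝ) (h : ℝ) (x y : Fin n → ℝ) (z : ℝ) : ℝ :=
  ((((designMatrix x z).transpose * weightMatrix K h x z * designMatrix x z)⁻¹ *
    (designMatrix x z).transpose * weightMatrix K h x z).mulVec y) 0

/-- The feasible method of moments estimator `p̂ = √(3n / (2 Σ ε̂_i²))` with the residuals
`ε̂_i = y_i - ĝ(x_i)`. -/
noncomputable def pHat {n : ℕ} (K : ℝ → ℝ) (h : ℝ) (x y : Fin n → ℝ) : ℝ :=
  Real.sqrt (3 * n / (2 * ∑ i, (y i - localLinear K h x y (x i)) ^ 2))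

/-- The plug-in frontier estimator `f̂(z) = exp(3/(2p̂) - ĝ(z))`. -/
noncomputable def fHat {n : ℕ} (K : ℝ → ℝ) (h : ℝ) (x y : Fin n → ℝ) (z : ℝ) : ℝ :=
  Real.exp (3 / (2 * pHat K h x y) - localLinear K h x y z)

/-- The first `n` observations of a sequence of random variables, at the outcome `ω`. -/
def firstObs {Ω : Type*} (V : ℕ → Ω → ℝ) (n : ℕ) (ω : Ω) : Fin n → ℝ := fun i => V i ω

/-- `W n = O_p(r n)` for nonnegative extended real random quantities `W n`: for each `ε > 0` there
is `M` such that `P(W n > M r n) ≤ ε` for all large `n`. -/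
def IsBigOp {Ω : Type*} [MeasurableSpace Ω] (μ : Measure Ω) (W : ℕ → Ω → ℝ≥0∞)
    (r : ℕ → ℝ) : Prop :=
  ∀ ε : ℝ, 0 < ε → ∃ M : ℝ, 0 < M ∧ ∀ᶠ n in atTop,
    μ {ω | ENNReal.ofReal (M * r n) < W n ω} ≤ ENNReal.ofReal ε

/-- The rate `h² + √(ln n / (n h))`. -/
noncomputable def rate (h : ℕ → ℝ) (n : ℕ) : ℝ :=
  h n ^ 2 + Real.sqrt (Real.log n / (n * h n))

end Frontier

namespace Frontier

/-! Taking logarithms turns the model into Z = g(X) + ε, where -ln R is Gamma distributed with shape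
3/2 and rate p. Hence ε = -ln R - 3/(2p) is centred, independent of X, has variance 3/(2p²) and has
exponential moments.

The error of a local linear fit against any affine function of x - z is a quotient of weighted sums
(`localLinear_sub_eq`). With the Taylor line of g at z as that function, the numerator contains only
kernel-weighted noise and a remainder with weights h²|u|^(j+2)|K(u)|, u = (x - z)/h. Three facts
finish the fit. Weighted sums deviate from their means by O(√(ln n/(nh))) uniformly in z
(`IsProductSample.uniform_deviation`: Chernoff at the points of a polynomially fine grid, Lipschitz
continuity between them). The remainder sums have mean O(h²) (`uniform_bound_remainder`). The
denominator is close to fX(z)² times the determinant of the kernel moments over the rescaled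
support, which A2' keeps away from zero uniformly, end points included (`exists_le_abs_det_Icc`). So
ĝ - g is uniformly of the stated rate (`localLinear_uniform`).

Residuals then differ uniformly little from errors, whose mean square is within √(ln n/(nh)) of
3/(2p²) by Chebyshev. Solving for p gives `pHat_uniform`, and exponentiating gives `fHat_uniform`.
-/

/-! ### Taylor bounds on the support -/

theorem HasRegularSecondDeriv.taylor {a b : ℝ} {F : ℝ → ℝ} (hF : HasRegularSecondDeriv a b F) :
    ∃ C, 0 ≤ C ∧ ∀ z ∈ Set.Icc a b, |derivWithin F (Set.Icc a b) z| ≤ C ∧ ∀ x ∈ Set.Icc a b,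
      |F x - F z - derivWithin F (Set.Icc a b) z * (x - z)| ≤ C * (x - z) ^ 2 := by
  obtain ⟨C, hC⟩ := hF.bounded
  have hcont : ContinuousOn (derivWithin F (Set.Icc a b)) (Set.Icc a b) :=
    hF.diff_deriv.continuousOn
  obtain ⟨D, hD⟩ := isCompact_Icc.exists_bound_of_continuousOn hcont
  refine ⟨max (max C D) 0, le_max_right _ _, fun z hz => ⟨?_, fun x hx => ?_⟩⟩
  · exact (hD z hz).trans ((le_max_right _ _).trans (le_max_left _ _))
  have hlip : ∀ y ∈ Set.Icc a b, ‖derivWithin F (Set.Icc a b) y - derivWithin F (Set.Icc a b) z‖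
      ≤ C * ‖y - z‖ := fun y hy =>
    (convex_Icc a b).norm_image_sub_le_of_norm_derivWithin_le hF.diff_deriv hC hz hy
  have hC0 : 0 ≤ C := (abs_nonneg _).trans (hC z hz)
  have hsub : Set.uIcc z x ⊆ Set.Icc a b := Set.uIcc_subset_Icc hz hx
  -- On the segment from z to x the function F y - F'(z) y has derivative at most C|x - z|, so the
  -- mean value inequality suffices; the factor 1/2 is given up.
  have key := (convex_uIcc z x).norm_image_sub_le_of_norm_hasDerivWithin_le
    (f := fun y => F y - derivWithin F (Set.Icc a b) z * y)
    (f' := fun y => derivWithin F (Set.Icc a b) y - derivWithin F (Set.Icc a b) z)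
    (C := C * ‖x - z‖) (x := z) (y := x) (fun y hy => by
      have h1 := ((hF.diff y (hsub hy)).hasDerivWithinAt.mono hsub)
      have h2 := ((hasDerivWithinAt_id y (Set.uIcc z x)).const_mul
        (derivWithin F (Set.Icc a b) z))
      exact (h1.sub h2).congr_deriv (by simp)) (fun y hy => by
      refine (hlip y (hsub hy)).trans ?_
      have := Set.abs_sub_left_of_mem_uIcc hy
      gcongr
      simpa [Real.norm_eq_abs, abs_sub_comm] using this)
    Set.left_mem_uIcc Set.right_mem_uIcc
  simp only [Real.norm_eq_abs] at key
  have e : F x - F z - derivWithin F (Set.Icc a b) z * (x - z) =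
    F x - derivWithin F (Set.Icc a b) z * x - (F z - derivWithin F (Set.Icc a b) z * z) := by ring
  rw [e]
  refine key.trans ?_
  rw [mul_assoc, ← sq, sq_abs]
  gcongr
  exact (le_max_left _ _).trans (le_max_left _ _)

theorem exists_abs_le_on_Icc {a b : ℝ} {F : ℝ → ℝ} (hF : DifferentiableOn ℝ F (Set.Icc a b)) :
    ∃ C, 0 ≤ C ∧ ∀ x ∈ Set.Icc a b, |F x| ≤ C := by
  obtain ⟨D, hD⟩ := isCompact_Icc.exists_bound_of_continuousOn hF.continuousOn
  exact ⟨max D 0, le_max_right _ _, fun x hx => (hD x hx).trans (le_max_left _ _)⟩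

/-- A function with regular second derivative is Lipschitz. -/
theorem HasRegularSecondDeriv.lipschitz {a b : ℝ} {F : ℝ → ℝ} (hF : HasRegularSecondDeriv a b F) :
    ∃ C, 0 ≤ C ∧ ∀ z ∈ Set.Icc a b, ∀ x ∈ Set.Icc a b, |F x - F z| ≤ C * |x - z| := by
  obtain ⟨C, hC0, hC⟩ := hF.taylor
  exact ⟨C, hC0, fun z hz x hx =>
    (convex_Icc a b).norm_image_sub_le_of_norm_derivWithin_le hF.diff (fun y hy => (hC y hy).1) hz hx⟩

/-- First order Taylor expansion of a quotient of functions with regular second derivatives. -/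
theorem exists_taylor_quotient {a b : ℝ} {q g : ℝ → ℝ}
    (hq : HasRegularSecondDeriv a b q) (hqg : HasRegularSecondDeriv a b fun x => q x * g x)
    (hlow : ∃ c, 0 < c ∧ ∀ x ∈ Set.Icc a b, c ≤ q x) :
    ∃ C, 0 ≤ C ∧ ∀ z ∈ Set.Icc a b, |g z| ≤ C ∧ ∃ β, ∀ x ∈ Set.Icc a b,
      |g x - g z - β * (x - z)| ≤ C * (x - z) ^ 2 := by
  obtain ⟨c, hc, hcq⟩ := hlow
  obtain ⟨C₁, hC₁, h₁⟩ := hq.taylor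
  obtain ⟨C₂, hC₂, h₂⟩ := hqg.taylor
  obtain ⟨L, hL, hLip⟩ := hq.lipschitz
  obtain ⟨G, hG, hGb⟩ := exists_abs_le_on_Icc hqg.diff
  set d₁ := derivWithin q (Set.Icc a b)
  set d₂ := derivWithin (fun x => q x * g x) (Set.Icc a b)
  have hg : ∀ z ∈ Set.Icc a b, |g z| ≤ G / c := fun z hz => by
    rw [le_div_iff₀ hc]
    have h := hGb z hz
    rw [abs_mul, abs_of_pos (hc.trans_le (hcq z hz))] at h
    nlinarith [hcq z hz, abs_nonneg (g z)]
  have hβ : ∀ z ∈ Set.Icc a b, |(d₂ z - g z * d₁ z) / q z| ≤ (C₂ + G / c * C₁) / c := by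
    intro z hz
    rw [abs_div, abs_of_pos (hc.trans_le (hcq z hz))]
    have : |d₂ z - g z * d₁ z| ≤ C₂ + G / c * C₁ := by
      refine (abs_sub _ _).trans (add_le_add (h₂ z hz).1 ?_)
      rw [abs_mul]
      exact mul_le_mul (hg z hz) (h₁ z hz).1 (abs_nonneg _) (by positivity)
    exact div_le_div₀ (by positivity) this hc (hcq z hz)
  refine ⟨max (G / c) ((C₂ + G / c * C₁ + (C₂ + G / c * C₁) / c * L) / c), by positivity,
    fun z hz => ⟨(hg z hz).trans (le_max_left _ _), (d₂ z - g z * d₁ z) / q z, fun x hx => ?_⟩⟩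
  have hβz := hβ z hz
  obtain ⟨β, hβdef⟩ : ∃ β, β = (d₂ z - g z * d₁ z) / q z := ⟨_, rfl⟩
  rw [← hβdef] at hβz ⊢
  have hqx := hc.trans_le (hcq x hx)
  have hqz := hc.trans_le (hcq z hz)
  have hβq : β * q z = d₂ z - g z * d₁ z := by rw [hβdef]; field_simp
  -- β is g'(z) as given by the quotient rule. After multiplication by q x the remainder consists of
  -- the Taylor remainders of q g and q and a product of two first order increments, so g itself
  -- need not be differentiated.
  have e : q x * (g x - g z - β * (x - z)) =
      (q x * g x - q z * g z - d₂ z * (x - z)) - g z * (q x - q z - d₁ z * (x - z))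
        - β * ((q x - q z) * (x - z)) := by
    linear_combination (x - z) * (-hβq)
  have hb : |q x * (g x - g z - β * (x - z))| ≤
      (C₂ + G / c * C₁ + (C₂ + G / c * C₁) / c * L) * (x - z) ^ 2 := by
    rw [e]
    have t1 := (h₂ z hz).2 x hx
    have t2 : |g z * (q x - q z - d₁ z * (x - z))| ≤ G / c * (C₁ * (x - z) ^ 2) := by
      rw [abs_mul]
      exact mul_le_mul (hg z hz) ((h₁ z hz).2 x hx) (abs_nonneg _) (by positivity)
    have t3 : |β * ((q x - q z) * (x - z))| ≤ (C₂ + G / c * C₁) / c * (L * (x - z) ^ 2) := by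
      rw [abs_mul]
      refine mul_le_mul hβz ?_ (abs_nonneg _) (by positivity)
      rw [abs_mul, ← sq_abs (x - z), sq, ← mul_assoc]
      exact mul_le_mul_of_nonneg_right (hLip z hz x hx) (abs_nonneg _)
    have := (abs_sub _ _).trans (add_le_add ((abs_sub _ _).trans (add_le_add t1 t2)) t3)
    refine this.trans (le_of_eq (by ring))
  rw [abs_mul, abs_of_pos hqx] at hb
  have : |g x - g z - β * (x - z)| ≤
      (C₂ + G / c * C₁ + (C₂ + G / c * C₁) / c * L) / c * (x - z) ^ 2 := by
    rw [div_mul_eq_mul_div, le_div_iff₀ hc]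
    refine le_trans ?_ hb
    rw [mul_comm]
    exact mul_le_mul_of_nonneg_right (hcq x hx) (abs_nonneg _)
  refine this.trans ?_
  gcongr
  exact le_max_right _ _

/-! ### Regularity and moments of the kernel -/

theorem AssumptionA2.exists_lipschitz {K : ℝ → ℝ} (hK : AssumptionA2 K) :
    ∃ κ, 0 ≤ κ ∧ ∀ u u', |K u - K u'| ≤ κ * |u - u'| := by
  obtain ⟨κ, L, -, h⟩ := hK.regular
  rcases h with ⟨-, h⟩ | ⟨hd, hb, -⟩
  · exact ⟨max κ 0, le_max_right _ _, fun u u' => (h u u').trans (by gcongr; exact le_max_left _ _)⟩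
  · refine ⟨κ, (abs_nonneg _).trans (hb 0), fun u u' => ?_⟩
    exact convex_univ.norm_image_sub_le_of_norm_deriv_le (fun x _ => hd x) (fun x _ => hb x)
      (Set.mem_univ u') (Set.mem_univ u)

theorem AssumptionA2.continuous {K : ℝ → ℝ} (hK : AssumptionA2 K) : Continuous K := by
  obtain ⟨κ, hκ, h⟩ := hK.exists_lipschitz
  exact (LipschitzWith.of_dist_le_mul (K := ⟨κ, hκ⟩) fun u u' => h u u').continuous

theorem AssumptionA2.exists_bound {K : ℝ → ℝ} (hK : AssumptionA2 K) :
    ∃ C, 0 ≤ C ∧ ∀ j ≤ 2, ∀ u, |u| ^ j * |K u| ≤ C := by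
  obtain ⟨C₀, h₀⟩ := hK.bounded 0 (by simp)
  obtain ⟨C₁, h₁⟩ := hK.bounded 1 (by simp)
  obtain ⟨C₂, h₂⟩ := hK.bounded 2 (by simp)
  have n₀ := (abs_nonneg _).trans (h₀ 0)
  have n₁ := (abs_nonneg _).trans (h₁ 0)
  have n₂ := (abs_nonneg _).trans (h₂ 0)
  refine ⟨C₀ + C₁ + C₂, by positivity, fun j hj u => ?_⟩
  rw [← abs_pow, ← abs_mul]
  interval_cases j
  · linarith [h₀ u]
  · linarith [h₁ u]
  · linarith [h₂ u]

theorem AssumptionA2.integrable_abs {K : ℝ → ℝ} (hK : AssumptionA2 K) {j : ℕ} (hj : j ≤ 4) :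
    Integrable fun u : ℝ => |u| ^ j * |K u| := by
  have key : ∀ i ∈ ({0, 1, 2, 4} : Set ℕ), Integrable fun u : ℝ => |u| ^ i * |K u| := fun i hi => by
    simpa [abs_mul, abs_pow] using (hK.integrable i hi).abs
  interval_cases j
  · exact key 0 (by simp)
  · exact key 1 (by simp)
  · exact key 2 (by simp)
  -- The third moment is not among the assumed ones; |u|³ ≤ u² + u⁴ supplies it.
  · refine ((key 2 (by simp)).add (key 4 (by simp))).mono' ?_ (ae_of_all _ fun u => ?_)
    · have := hK.continuous
      fun_prop
    · rw [Real.norm_eq_abs, abs_of_nonneg (by positivity)]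
      simp only [Pi.add_apply, ← add_mul]
      gcongr
      nlinarith [sq_nonneg (|u| - 1), abs_nonneg u, sq_nonneg (|u|), sq_nonneg (|u| ^2 - |u|)]
  · exact key 4 (by simp)

theorem AssumptionA2.integrable_pow_mul {K : ℝ → ℝ} (hK : AssumptionA2 K) {j : ℕ} (hj : j ≤ 4) :
    Integrable fun u : ℝ => u ^ j * K u := by
  refine (hK.integrable_abs hj).mono' ?_ (ae_of_all _ fun u => by simp)
  have := hK.continuous
  fun_prop

/-! ### Truncated kernel moments and their determinant -/

/-- Symmetry of K exchanges the two ends of the support, so that truncation on the left is the only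
case to treat. -/
theorem setIntegral_Icc_neg_symm {K : ℝ → ℝ} (hK : ∀ u, K (-u) = K u) (j : ℕ) (α β : ℝ) :
    ∫ u in Set.Icc (-α) β, u ^ j * K u = (-1) ^ j * ∫ u in Set.Icc (-β) α, u ^ j * K u := by
  rw [← integral_indicator measurableSet_Icc, ← integral_indicator measurableSet_Icc,
    ← integral_neg_eq_self, ← integral_const_mul]
  congr 1 with u
  by_cases h : u ∈ Set.Icc (-β) α
  · have h' : -u ∈ Set.Icc (-α) β := ⟨by linarith [h.2], by linarith [h.1]⟩
    rw [Set.indicator_of_mem h, Set.indicator_of_mem h', hK, neg_pow]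
    ring
  · have h' : -u ∉ Set.Icc (-α) β := fun h' => h ⟨by linarith [h'.2], by linarith [h'.1]⟩
    rw [Set.indicator_of_notMem h, Set.indicator_of_notMem h', mul_zero]

theorem continuous_setIntegral_Ici_neg {φ : ℝ → ℝ} (hφ : Integrable φ) :
    Continuous fun c => ∫ u in Set.Ici (-c), φ u := by
  have e : (fun c => ∫ u in Set.Ici (-c), φ u) =
      fun c => (∫ u, φ u) - ((∫ u in Set.Iic 0, φ u) + ∫ u in (0 : ℝ)..(-c), φ u) := by
    ext c
    have h1 := integral_add_compl (measurableSet_Iic (a := -c)) hφ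
    have h2 := intervalIntegral.integral_Iic_sub_Iic (a := 0) (b := -c)
      (hφ.integrableOn) (hφ.integrableOn)
    rw [Set.compl_Iic] at h1
    rw [integral_Ici_eq_integral_Ioi]
    linarith
  rw [e]
  have := intervalIntegral.continuous_primitive (fun a b => hφ.intervalIntegrable (a := a) (b := b)) 0
  fun_prop

theorem tendsto_setIntegral_Ici_neg {φ : ℝ → ℝ} (hφ : Integrable φ) :
    Tendsto (fun c => ∫ u in Set.Ici (-c), φ u) atTop (𝓝 (∫ u, φ u)) :=
  (aecover_Ici tendsto_neg_atTop_atBot).integral_tendsto_of_countably_generated hφ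

theorem tendsto_setIntegral_Ioi_atTop_zero {φ : ℝ → ℝ} (hφ : Integrable φ) :
    Tendsto (fun c => ∫ u in Set.Ioi c, φ u) atTop (𝓝 0) := by
  have h := (aecover_Iic (μ := volume) (tendsto_id (α := ℝ))).integral_tendsto_of_countably_generated hφ
  have h' := h.const_sub (∫ u, φ u)
  rw [sub_self] at h'
  refine h'.congr fun c => ?_
  have h1 := integral_add_compl (measurableSet_Iic (a := c)) hφ
  rw [Set.compl_Iic] at h1
  simp only [id]
  linarith

theorem det_kernelMomentMatrix (K : ℝ → ℝ) (S : Set ℝ) :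
    (kernelMomentMatrix K S).det = (∫ u in S, u ^ 0 * K u) * (∫ u in S, u ^ 2 * K u)
      - (∫ u in S, u ^ 1 * K u) ^ 2 := by
  rw [Matrix.det_fin_two]
  simp only [kernelMomentMatrix, Matrix.of_apply, Fin.val_zero, Fin.val_one, add_zero, zero_add,
    one_add_one_eq_two]
  ring

/-- The determinant is continuous in c and tends to the nonzero full determinant as c → ∞. Only a
compact range of c remains, where a nonvanishing continuous function has a positive minimum of its
absolute value. -/
theorem exists_le_abs_det_Ici {K : ℝ → ℝ} (hA2 : AssumptionA2 K) (hK : KernelNondegenerate K) :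
    ∃ d, 0 < d ∧ ∀ c, 0 ≤ c → d ≤ |(kernelMomentMatrix K (Set.Ici (-c))).det| := by
  have hcont : Continuous fun c => (kernelMomentMatrix K (Set.Ici (-c))).det := by
    simp only [det_kernelMomentMatrix]
    have h0 := continuous_setIntegral_Ici_neg (hA2.integrable_pow_mul (j := 0) (by norm_num))
    have h1 := continuous_setIntegral_Ici_neg (hA2.integrable_pow_mul (j := 1) (by norm_num))
    have h2 := continuous_setIntegral_Ici_neg (hA2.integrable_pow_mul (j := 2) (by norm_num))
    exact (h0.mul h2).sub (h1.pow 2)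
  have hlim : Tendsto (fun c => (kernelMomentMatrix K (Set.Ici (-c))).det) atTop
      (𝓝 (kernelMomentMatrix K Set.univ).det) := by
    simp only [det_kernelMomentMatrix, setIntegral_univ]
    have h0 := tendsto_setIntegral_Ici_neg (hA2.integrable_pow_mul (j := 0) (by norm_num))
    have h1 := tendsto_setIntegral_Ici_neg (hA2.integrable_pow_mul (j := 1) (by norm_num))
    have h2 := tendsto_setIntegral_Ici_neg (hA2.integrable_pow_mul (j := 2) (by norm_num))
    exact (h0.mul h2).sub (h1.pow 2)
  have hpos := abs_pos.2 hK.interior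
  obtain ⟨T, hT⟩ := eventually_atTop.1 (hlim.abs.eventually (lt_mem_nhds (half_lt_self hpos)))
  obtain ⟨x, hx, hmin⟩ := (isCompact_Icc (a := 0) (b := max T 0)).exists_isMinOn
    ⟨0, le_rfl, le_max_right _ _⟩ hcont.abs.continuousOn
  refine ⟨_, lt_min (half_pos hpos) (abs_pos.2 (hK.boundary x hx.1)), fun c hc => ?_⟩
  rcases le_total T c with h | h
  · exact (min_le_left _ _).trans (hT c h).le
  · exact (min_le_right _ _).trans (hmin (a := c) ⟨hc, h.trans (le_max_left _ _)⟩)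

/-- Seen from z at scale h, the support is [-α, β] with α + β = (b - a)/h → ∞, so at least one end
is far away. Removing the far end costs only kernel tails and leaves a half-line. -/
theorem exists_le_abs_det_Icc {K : ℝ → ℝ} (hA2 : AssumptionA2 K) (hK : KernelNondegenerate K) :
    ∃ d T, 0 < d ∧ ∀ α β, 0 ≤ α → 0 ≤ β → T ≤ α + β →
      d ≤ |(kernelMomentMatrix K (Set.Icc (-α) β)).det| := by
  obtain ⟨d, hd, hD⟩ := exists_le_abs_det_Ici hA2 hK
  have hint := fun j (hj : j ≤ 2) => hA2.integrable_pow_mul (hj.trans (by norm_num : 2 ≤ 4))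
  set A : ℕ → ℝ := fun j => ∫ u, |u ^ j * K u|
  have hA : ∀ j, 0 ≤ A j := fun j => integral_nonneg fun u => abs_nonneg _
  have hset : ∀ j ≤ 2, ∀ S : Set ℝ, |∫ u in S, u ^ j * K u| ≤ A j := fun j hj S =>
    abs_integral_le_integral_abs.trans
      (setIntegral_le_integral (hint j hj).abs (ae_of_all _ fun u => abs_nonneg _))
  have hdiff : ∀ j ≤ 2, ∀ α β, 0 ≤ α → 0 ≤ β →
      |(∫ u in Set.Icc (-α) β, u ^ j * K u) - ∫ u in Set.Ici (-α), u ^ j * K u| ≤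
        ∫ u in Set.Ioi β, |u ^ j * K u| := fun j hj α β hα hβ => by
    have hu : Set.Ici (-α) = Set.Icc (-α) β ∪ Set.Ioi β :=
      (Set.Icc_union_Ioi_eq_Ici (by linarith)).symm
    have hdisj : Disjoint (Set.Icc (-α) β) (Set.Ioi β) :=
      Set.disjoint_left.2 fun x hx hx' => not_lt.2 hx.2 hx'
    rw [hu, setIntegral_union hdisj
      measurableSet_Ioi (hint j hj).integrableOn (hint j hj).integrableOn, sub_add_cancel_left, abs_neg]
    exact abs_integral_le_integral_abs
  have htail : Tendsto (fun β => (∫ u in Set.Ioi β, |u ^ 0 * K u|) * A 2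
      + A 0 * (∫ u in Set.Ioi β, |u ^ 2 * K u|)
      + (∫ u in Set.Ioi β, |u ^ 1 * K u|) * (A 1 + A 1)) atTop (𝓝 0) := by
    have h0 := tendsto_setIntegral_Ioi_atTop_zero (hint 0 (by norm_num)).abs
    have h1 := tendsto_setIntegral_Ioi_atTop_zero (hint 1 (by norm_num)).abs
    have h2 := tendsto_setIntegral_Ioi_atTop_zero (hint 2 (by norm_num)).abs
    simpa using ((h0.mul_const (A 2)).add (h2.const_mul (A 0))).add (h1.mul_const (A 1 + A 1))
  obtain ⟨T, hT⟩ := eventually_atTop.1 (htail.eventually (gt_mem_nhds (half_pos hd)))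
  have main : ∀ α β, 0 ≤ α → 0 ≤ β → T ≤ β →
      d / 2 ≤ |(kernelMomentMatrix K (Set.Icc (-α) β)).det| := fun α β hα hβ hTβ => by
    have hDα := hD α hα
    rw [det_kernelMomentMatrix] at hDα ⊢
    have e0 := hdiff 0 (by norm_num) α β hα hβ
    have e1 := hdiff 1 (by norm_num) α β hα hβ
    have e2 := hdiff 2 (by norm_num) α β hα hβ
    have i0 := hset 0 (by norm_num) (Set.Ici (-α))
    have i1 := hset 1 (by norm_num) (Set.Ici (-α))
    have m1 := hset 1 (by norm_num) (Set.Icc (-α) β)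
    have m2 := hset 2 (by norm_num) (Set.Icc (-α) β)
    have ht := hT β hTβ
    generalize (∫ u in Set.Icc (-α) β, u ^ 0 * K u) = M0 at *
    generalize (∫ u in Set.Icc (-α) β, u ^ 1 * K u) = M1 at *
    generalize (∫ u in Set.Icc (-α) β, u ^ 2 * K u) = M2 at *
    generalize (∫ u in Set.Ici (-α), u ^ 0 * K u) = I0 at *
    generalize (∫ u in Set.Ici (-α), u ^ 1 * K u) = I1 at *
    generalize (∫ u in Set.Ici (-α), u ^ 2 * K u) = I2 at *
    have e : (I0 * I2 - I1 ^ 2) - (M0 * M2 - M1 ^ 2) =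
        -((M0 - I0) * M2) - I0 * (M2 - I2) + (M1 - I1) * (M1 + I1) := by ring
    have b0 : |(M0 - I0) * M2| ≤ (∫ u in Set.Ioi β, |u ^ 0 * K u|) * A 2 := by
      rw [abs_mul]
      exact mul_le_mul e0 m2 (abs_nonneg _) ((abs_nonneg _).trans e0)
    have b2 : |I0 * (M2 - I2)| ≤ A 0 * (∫ u in Set.Ioi β, |u ^ 2 * K u|) := by
      rw [abs_mul]
      exact mul_le_mul i0 e2 (abs_nonneg _) (hA 0)
    have b1 : |(M1 - I1) * (M1 + I1)| ≤ (∫ u in Set.Ioi β, |u ^ 1 * K u|) * (A 1 + A 1) := by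
      rw [abs_mul]
      exact mul_le_mul e1 ((abs_add_le _ _).trans (add_le_add m1 i1)) (abs_nonneg _)
        ((abs_nonneg _).trans e1)
    have hclose : |(I0 * I2 - I1 ^ 2) - (M0 * M2 - M1 ^ 2)| ≤ d / 2 := by
      rw [e]
      refine (abs_add_le _ _).trans (le_trans (add_le_add (abs_sub _ _) b1) ?_)
      rw [abs_neg]
      linarith
    have := abs_sub_abs_le_abs_sub (I0 * I2 - I1 ^ 2) (M0 * M2 - M1 ^ 2)
    linarith
  -- If α + β ≥ 2T, then α ≥ T or β ≥ T. Reflection exchanges the cases: it changes only the sign of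
  -- the first moment, which enters the determinant squared.
  refine ⟨d / 2, 2 * T, half_pos hd, fun α β hα hβ h => ?_⟩
  rcases le_total T β with hTβ | hTβ
  · exact main α β hα hβ hTβ
  · have hs := main β α hβ hα (by linarith)
    have hr : (kernelMomentMatrix K (Set.Icc (-α) β)).det =
        (kernelMomentMatrix K (Set.Icc (-β) α)).det := by
      rw [det_kernelMomentMatrix, det_kernelMomentMatrix]
      simp only [setIntegral_Icc_neg_symm hA2.symmetric _ α β]
      ring
    rwa [hr]

/-! ### Product samples and events of probability tending to one -/

/-- The pairs `(X i, R i)` are independent over `i`, with independent components of laws `PX`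
and `PR`. -/
structure IsProductSample {Ω : Type*} [MeasurableSpace Ω] (μ : Measure Ω) (PX PR : Measure ℝ)
    (X R : ℕ → Ω → ℝ) : Prop where
  measurable_X : ∀ i, Measurable (X i)
  measurable_R : ∀ i, Measurable (R i)
  indep_units : iIndepFun (fun i ω => (X i ω, R i ω)) μ
  indep : ∀ i, IndepFun (X i) (R i) μ
  law_X : ∀ i, μ.map (X i) = PX
  law_R : ∀ i, μ.map (R i) = PR

/-- The events `P n` have probability tending to one. -/
def WithHighProb {Ω : Type*} [MeasurableSpace Ω] (μ : Measure Ω) (P : ℕ → Ω → Prop) : Prop :=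
  Tendsto (fun n => μ {ω | ¬ P n ω}) atTop (𝓝 0)

section WithHighProb

variable {Ω : Type*} [MeasurableSpace Ω] {μ : Measure Ω} {P Q : ℕ → Ω → Prop}

theorem WithHighProb.of_le (f : ℕ → ℝ≥0∞) (hf : Tendsto f atTop (𝓝 0))
    (h : ∀ᶠ n in atTop, μ {ω | ¬ P n ω} ≤ f n) : WithHighProb μ P :=
  tendsto_of_tendsto_of_tendsto_of_le_of_le' tendsto_const_nhds hf (Eventually.of_forall fun _ => zero_le) h

theorem WithHighProb.mono (hP : WithHighProb μ P) (h : ∀ᶠ n in atTop, ∀ ω, P n ω → Q n ω) :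
    WithHighProb μ Q :=
  .of_le _ hP (h.mono fun _ hn => measure_mono fun ω hω hPω => hω (hn ω hPω))

theorem WithHighProb.and (hP : WithHighProb μ P) (hQ : WithHighProb μ Q) :
    WithHighProb μ fun n ω => P n ω ∧ Q n ω := by
  refine .of_le (fun n => μ {ω | ¬ P n ω} + μ {ω | ¬ Q n ω}) (by simpa using Tendsto.add hP hQ)
    (Eventually.of_forall fun n => ?_)
  refine (measure_mono fun ω hω => ?_).trans (measure_union_le _ _)
  exact not_and_or.1 hω

theorem WithHighProb.of_ae {P : Ω → Prop} (h : ∀ᵐ ω ∂μ, P ω) : WithHighProb μ fun _ => P := by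
  have : μ {ω | ¬ P ω} = 0 := h
  simp [WithHighProb, this]

/-- One M with failure probability tending to zero serves every ε. Such events are stable under
finite intersections, so the argument can run with fixed constants throughout. -/
theorem WithHighProb.isBigOp {W : ℕ → Ω → ℝ≥0∞} {r : ℕ → ℝ} {M : ℝ} (hM : 0 < M)
    (h : WithHighProb μ fun n ω => W n ω ≤ ENNReal.ofReal (M * r n)) : IsBigOp μ W r := by
  intro ε hε
  refine ⟨M, hM, ?_⟩
  have := (ENNReal.tendsto_nhds_zero.1 h) (ENNReal.ofReal ε) (by simpa using hε)
  simpa only [not_le] using this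

end WithHighProb

/-! ### A Chernoff bound for sums of products w(X) v(R) -/

section Chernoff

variable {Ω : Type*} [MeasurableSpace Ω] {μ : Measure Ω}
  {PX PR : Measure ℝ} {X R : ℕ → Ω → ℝ} {v : ℝ → ℝ} {l : ℝ}

theorem IsProductSample.integrable_mul (hS : IsProductSample μ PX PR X R) {φ ψ : ℝ → ℝ}
    (hφm : Measurable φ) (hψm : Measurable ψ) (hφ : Integrable φ PX) (hψ : Integrable ψ PR) (i : ℕ) :
    Integrable (fun ω => φ (X i ω) * ψ (R i ω)) μ ∧
      ∫ ω, φ (X i ω) * ψ (R i ω) ∂μ = (∫ x, φ x ∂PX) * ∫ r, ψ r ∂PR := by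
  have hφ' : Integrable (φ ∘ X i) μ :=
    (integrable_map_measure hφm.aestronglyMeasurable (hS.measurable_X i).aemeasurable).1
      (by rwa [hS.law_X i])
  have hψ' : Integrable (ψ ∘ R i) μ :=
    (integrable_map_measure hψm.aestronglyMeasurable (hS.measurable_R i).aemeasurable).1
      (by rwa [hS.law_R i])
  have hi : IndepFun (φ ∘ X i) (ψ ∘ R i) μ := (hS.indep i).comp hφm hψm
  refine ⟨hi.integrable_mul hφ' hψ', ?_⟩
  rw [← hS.law_X i, ← hS.law_R i, integral_map (hS.measurable_X i).aemeasurable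
    hφm.aestronglyMeasurable, integral_map (hS.measurable_R i).aemeasurable
    hψm.aestronglyMeasurable]
  exact hi.integral_mul_eq_mul_integral hφ'.1 hψ'.1

theorem IsProductSample.ae_X (hS : IsProductSample μ PX PR X R) {p : ℝ → Prop}
    (hp : ∀ᵐ x ∂PX, p x) (i : ℕ) : ∀ᵐ ω ∂μ, p (X i ω) := by
  rw [← hS.law_X i] at hp
  exact ae_of_ae_map (hS.measurable_X i).aemeasurable hp

theorem IsProductSample.ae_R (hS : IsProductSample μ PX PR X R) {p : ℝ → Prop}
    (hp : ∀ᵐ x ∂PR, p x) (i : ℕ) : ∀ᵐ ω ∂μ, p (R i ω) := by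
  rw [← hS.law_R i] at hp
  exact ae_of_ae_map (hS.measurable_R i).aemeasurable hp

variable [IsProbabilityMeasure μ]

/-- The Taylor remainder of exp in a form whose expectation is controlled by that of v² exp(l|v|).
-/
theorem exp_le_one_add_add_sq_mul_exp_abs (y : ℝ) :
    Real.exp y ≤ 1 + y + y ^ 2 * Real.exp |y| := by
  have h := Complex.norm_exp_sub_sum_le_norm_mul_exp (y : ℂ) 2
  simp only [Finset.sum_range_succ, Finset.sum_range_zero, pow_zero, pow_one, Nat.factorial,
    Nat.cast_one, div_one, zero_add, mul_one] at h
  rw [← Complex.ofReal_exp, ← Complex.ofReal_one, ← Complex.ofReal_add, ← Complex.ofReal_sub,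
    Complex.norm_real, Complex.norm_real, Real.norm_eq_abs, Real.norm_eq_abs, sq_abs] at h
  linarith [le_abs_self (Real.exp y - (1 + y))]

theorem integrable_of_integrable_sq_mul_exp [IsFiniteMeasure PR] (hv : Measurable v) (hl : 0 ≤ l)
    (hint : Integrable (fun r => v r ^ 2 * Real.exp (l * |v r|)) PR) : Integrable v PR := by
  refine ((integrable_const (1 : ℝ)).add hint).mono' hv.aestronglyMeasurable
    (ae_of_all _ fun r => ?_)
  simp only [Pi.add_apply, Real.norm_eq_abs]
  have h1 : 1 ≤ Real.exp (l * |v r|) := Real.one_le_exp (by positivity)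
  nlinarith [sq_nonneg (|v r| - 1), sq_abs (v r), sq_nonneg (v r)]

theorem IsProductSample.isProbabilityMeasure_PX (hS : IsProductSample μ PX PR X R) :
    IsProbabilityMeasure PX :=
  hS.law_X 0 ▸ Measure.isProbabilityMeasure_map (hS.measurable_X 0).aemeasurable

theorem IsProductSample.isProbabilityMeasure_PR (hS : IsProductSample μ PX PR X R) :
    IsProbabilityMeasure PR :=
  hS.law_R 0 ▸ Measure.isProbabilityMeasure_map (hS.measurable_R 0).aemeasurable

theorem integrable_of_ae_bound {PX : Measure ℝ} [IsFiniteMeasure PX] {w : ℝ → ℝ} (hw : Measurable w)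
    {B : ℝ} (hB : ∀ᵐ x ∂PX, |w x| ≤ B) : Integrable w PX :=
  (integrable_const B).mono' hw.aestronglyMeasurable hB

/-- The mean is kept exactly in the exponent, and the quadratic term carries ∫ w², which is O(h) for
kernel weights; this is the source of nh in the rate. The condition t B ≤ l dominates exp(t|w v|) by
exp(l|v|). -/
theorem IsProductSample.mgf_le (hS : IsProductSample μ PX PR X R) (hv : Measurable v)
    (hint : Integrable (fun r => v r ^ 2 * Real.exp (l * |v r|)) PR) {w : ℝ → ℝ} (hw : Measurable w)
    {B : ℝ} (hB : ∀ᵐ x ∂PX, |w x| ≤ B) (hB0 : 0 ≤ B) {t : ℝ} (ht : 0 ≤ t) (htB : t * B ≤ l) (i : ℕ) :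
    Integrable (fun ω => Real.exp (t * (w (X i ω) * v (R i ω)))) μ ∧
      mgf (fun ω => w (X i ω) * v (R i ω)) μ t ≤ Real.exp (t * ((∫ x, w x ∂PX) * ∫ r, v r ∂PR) +
        t ^ 2 * ((∫ x, w x ^ 2 ∂PX) * ∫ r, v r ^ 2 * Real.exp (l * |v r|) ∂PR)) := by
  have := hS.isProbabilityMeasure_PX
  have := hS.isProbabilityMeasure_PR
  have hl : 0 ≤ l := (mul_nonneg ht hB0).trans htB
  have hwi : Integrable w PX := integrable_of_ae_bound hw hB
  have hw2 : Integrable (fun x => w x ^ 2) PX :=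
    integrable_of_ae_bound (hw.pow_const 2) (B := B ^ 2) (hB.mono fun x hx => by
      rw [abs_pow]; exact pow_le_pow_left₀ (abs_nonneg _) hx 2)
  have hvi := integrable_of_integrable_sq_mul_exp hv hl hint
  obtain ⟨i1, e1⟩ := hS.integrable_mul hw hv hwi hvi i
  obtain ⟨i2, e2⟩ := hS.integrable_mul (hw.pow_const 2)
    (by fun_prop : Measurable fun r => v r ^ 2 * Real.exp (l * |v r|)) hw2 hint i
  have hle : ∀ᵐ ω ∂μ, Real.exp (t * (w (X i ω) * v (R i ω))) ≤
      1 + t * (w (X i ω) * v (R i ω)) +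
        t ^ 2 * (w (X i ω) ^ 2 * (v (R i ω) ^ 2 * Real.exp (l * |v (R i ω)|))) := by
    filter_upwards [hS.ae_X hB i] with ω hω
    refine (exp_le_one_add_add_sq_mul_exp_abs _).trans ?_
    have h2 : |t * (w (X i ω) * v (R i ω))| ≤ l * |v (R i ω)| := by
      rw [abs_mul, abs_mul, abs_of_nonneg ht, ← mul_assoc]
      refine mul_le_mul_of_nonneg_right (le_trans ?_ htB) (abs_nonneg _)
      exact mul_le_mul_of_nonneg_left hω ht
    have h3 := Real.exp_le_exp.2 h2
    have h4 := mul_le_mul_of_nonneg_left h3 (sq_nonneg (t * (w (X i ω) * v (R i ω))))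
    rw [mul_pow, mul_pow] at h4
    rw [mul_pow, mul_pow]
    linarith
  have hrhs : Integrable (fun ω => 1 + t * (w (X i ω) * v (R i ω)) +
        t ^ 2 * (w (X i ω) ^ 2 * (v (R i ω) ^ 2 * Real.exp (l * |v (R i ω)|)))) μ :=
    ((integrable_const _).add (i1.const_mul t)).add (i2.const_mul (t ^ 2))
  have hX := hS.measurable_X i
  have hR := hS.measurable_R i
  have hexp : Integrable (fun ω => Real.exp (t * (w (X i ω) * v (R i ω)))) μ :=
    hrhs.mono' (by fun_prop) (hle.mono fun ω h => by
      rwa [Real.norm_eq_abs, abs_of_pos (Real.exp_pos _)])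
  refine ⟨hexp, (integral_mono_ae hexp hrhs hle).trans ?_⟩
  have hsum := integral_add (f := fun ω => 1 + t * (w (X i ω) * v (R i ω)))
    ((integrable_const (1 : ℝ)).add (i1.const_mul t)) (i2.const_mul (t ^ 2))
  rw [hsum,
    integral_add (integrable_const _) (i1.const_mul t), integral_const_mul, integral_const_mul,
    e1, e2, integral_const, probReal_univ, one_smul, add_assoc, add_comm 1]
  exact Real.add_one_le_exp _

theorem IsProductSample.measure_le_sum_le (hS : IsProductSample μ PX PR X R) (hv : Measurable v)
    (hint : Integrable (fun r => v r ^ 2 * Real.exp (l * |v r|)) PR) {w : ℝ → ℝ} (hw : Measurable w)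
    {B : ℝ} (hB : ∀ᵐ x ∂PX, |w x| ≤ B) (hB0 : 0 ≤ B) {t : ℝ} (ht : 0 ≤ t) (htB : t * B ≤ l)
    (n : ℕ) (s : ℝ) :
    μ.real {ω | s ≤ ∑ i ∈ Finset.range n, w (X i ω) * v (R i ω) -
        n * ((∫ x, w x ∂PX) * ∫ r, v r ∂PR)} ≤
      Real.exp (-t * s + n * (t ^ 2 * ((∫ x, w x ^ 2 ∂PX) *
        ∫ r, v r ^ 2 * Real.exp (l * |v r|) ∂PR))) := by
  have hind : iIndepFun (fun i ω => w (X i ω) * v (R i ω)) μ :=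
    hS.indep_units.comp (fun _ q => w q.1 * v q.2) fun _ => by fun_prop
  have hmeas : ∀ i, Measurable fun ω => w (X i ω) * v (R i ω) := fun i => by
    have hX := hS.measurable_X i
    have hR := hS.measurable_R i
    fun_prop
  have hi := fun i => hS.mgf_le hv hint hw hB hB0 ht htB i
  have hexp := hind.integrable_exp_mul_sum hmeas (s := Finset.range n) (t := t)
    fun i _ => (hi i).1
  have hmgf := hind.mgf_sum hmeas (Finset.range n) (t := t)
  have h := measure_ge_le_exp_mul_mgf (μ := μ) (X := ∑ i ∈ Finset.range n, fun ω => w (X i ω) * v (R i ω))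
    (s + n * ((∫ x, w x ∂PX) * ∫ r, v r ∂PR)) ht hexp
  rw [hmgf] at h
  have hprod := Finset.prod_le_prod (s := Finset.range n) (fun i _ => mgf_nonneg) fun i _ => (hi i).2
  rw [Finset.prod_const, Finset.card_range, ← Real.exp_nat_mul] at hprod
  have h' := h.trans (mul_le_mul_of_nonneg_left hprod (Real.exp_pos _).le)
  rw [← Real.exp_add] at h'
  refine le_trans (le_of_eq ?_) (h'.trans (le_of_eq ?_))
  · congr 1 with ω
    simp only [Set.mem_ofPred_eq, Finset.sum_apply, le_sub_iff_add_le]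
  · congr 1
    ring

theorem IsProductSample.measure_lt_abs_sum_le (hS : IsProductSample μ PX PR X R) (hv : Measurable v)
    (hint : Integrable (fun r => v r ^ 2 * Real.exp (l * |v r|)) PR) {w : ℝ → ℝ} (hw : Measurable w)
    {B : ℝ} (hB : ∀ᵐ x ∂PX, |w x| ≤ B) (hB0 : 0 ≤ B) {t : ℝ} (ht : 0 ≤ t) (htB : t * B ≤ l)
    (n : ℕ) (s : ℝ) :
    μ.real {ω | s < |∑ i ∈ Finset.range n, w (X i ω) * v (R i ω) -
        n * ((∫ x, w x ∂PX) * ∫ r, v r ∂PR)|} ≤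
      2 * Real.exp (-t * s + n * (t ^ 2 * ((∫ x, w x ^ 2 ∂PX) *
        ∫ r, v r ^ 2 * Real.exp (l * |v r|) ∂PR))) := by
  have h1 := hS.measure_le_sum_le hv hint hw hB hB0 ht htB n s
  have h2 := hS.measure_le_sum_le hv hint hw.neg (B := B) (by simpa using hB) hB0 ht htB n s
  simp only [Pi.neg_apply, neg_sq, integral_neg, neg_mul, Finset.sum_neg_distrib, mul_neg] at h1 h2
  rw [neg_mul, two_mul]
  refine le_trans (le_trans (measureReal_mono fun ω hω => ?_) (measureReal_union_le _ _))
    (add_le_add h1 h2)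
  rcases lt_abs.1 (Set.mem_ofPred_eq ▸ hω) with h | h
  · exact Or.inl h.le
  · right
    simp only [Set.mem_ofPred_eq]
    linarith

end Chernoff

/-! ### Consequences of the bandwidth condition -/

section Bandwidth

variable {h : ℕ → ℝ}

theorem AssumptionA5.tendsto_sqrt (hh : AssumptionA5 h) :
    Tendsto (fun n : ℕ => √(Real.log n / (n * h n))) atTop (𝓝 0) := by
  simpa using hh.rate.sqrt

theorem AssumptionA5.tendsto_rate (hh : AssumptionA5 h) : Tendsto (Frontier.rate h) atTop (𝓝 0) := by
  have := (hh.tendsto.pow 2).add hh.tendsto_sqrt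
  rw [show (0 : ℝ) ^ 2 + 0 = 0 by norm_num] at this
  exact this

theorem eventually_one_le_log : ∀ᶠ n : ℕ in atTop, 1 ≤ Real.log n :=
  (Real.tendsto_log_atTop.comp tendsto_natCast_atTop_atTop).eventually_ge_atTop 1

/-- Since 1 ≤ ln n < nh eventually. Thus Lipschitz constants in powers of 1/h are polynomial in n.
-/
theorem AssumptionA5.eventually_inv_le (hh : AssumptionA5 h) : ∀ᶠ n : ℕ in atTop, 1 / h n ≤ n := by
  filter_upwards [hh.rate.eventually (gt_mem_nhds one_pos), eventually_one_le_log,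
    eventually_gt_atTop 0] with n h1 h2 h3
  have hn : (0 : ℝ) < n := by exact_mod_cast h3
  rw [div_lt_one (mul_pos hn (hh.pos n))] at h1
  rw [div_le_iff₀ (hh.pos n)]
  linarith

theorem AssumptionA5.eventually_le_one (hh : AssumptionA5 h) : ∀ᶠ n in atTop, h n ≤ 1 :=
  hh.tendsto.eventually_le_const one_pos

/-- Discretisation errors of order 1/n are absorbed by the stochastic rate. -/
theorem AssumptionA5.eventually_one_div_le_sqrt (hh : AssumptionA5 h) :
    ∀ᶠ n : ℕ in atTop, 1 / (n : ℝ) ≤ √(Real.log n / (n * h n)) := by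
  filter_upwards [hh.eventually_le_one, eventually_one_le_log, eventually_gt_atTop 0] with n h1 h2 h3
  have hn : (1 : ℝ) ≤ n := by exact_mod_cast h3
  have hp := hh.pos n
  apply Real.le_sqrt_of_sq_le
  rw [div_pow, one_pow, div_le_div_iff₀ (by positivity) (by positivity)]
  have : (n : ℝ) * h n ≤ n * 1 := by gcongr
  nlinarith

/-- With Chernoff parameter t equal to the rate, both terms of the exponent become multiples of ln
n. -/
theorem AssumptionA5.eventually_mul_sq (hh : AssumptionA5 h) :
    ∀ᶠ n : ℕ in atTop, n * h n * √(Real.log n / (n * h n)) ^ 2 = Real.log n := by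
  filter_upwards [eventually_one_le_log, eventually_gt_atTop 0] with n h2 h3
  have hn : (0 : ℝ) < n := by exact_mod_cast h3
  have hp := hh.pos n
  rw [Real.sq_sqrt (by positivity)]
  field_simp

end Bandwidth

/-! ### Uniform deviations by discretisation -/

theorem exists_grid_point {a b : ℝ} (hab : a < b) {N : ℕ} (hN : 0 < N) {z : ℝ}
    (hz : z ∈ Set.Icc a b) :
    ∃ k ∈ Finset.range (N + 1), a + (b - a) * k / N ∈ Set.Icc a b ∧
      |z - (a + (b - a) * k / N)| ≤ (b - a) / N := by
  have hN' : (0 : ℝ) < N := by exact_mod_cast hN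
  have hba : 0 < b - a := sub_pos.2 hab
  have hq : 0 ≤ (z - a) * N / (b - a) := by
    have := hz.1
    have : 0 ≤ z - a := by linarith
    positivity
  have h1 := Nat.floor_le hq
  have h2 := Nat.lt_floor_add_one ((z - a) * N / (b - a))
  have h3 : (z - a) * N / (b - a) ≤ N := by
    rw [div_le_iff₀ hba, mul_comm]
    gcongr
    exact hz.2
  set k := ⌊(z - a) * N / (b - a)⌋₊
  have hkN : (k : ℝ) ≤ N := h1.trans h3
  rw [le_div_iff₀ hba] at h1
  rw [div_lt_iff₀ hba] at h2
  have e1 : (b - a) * k / N ≤ z - a := by rw [div_le_iff₀ hN']; linarith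
  have e2 : z - a ≤ (b - a) * k / N + (b - a) / N := by
    rw [← add_div, le_div_iff₀ hN']; nlinarith
  refine ⟨k, Finset.mem_range_succ_iff.2 (by exact_mod_cast hkN), ⟨?_, ?_⟩, ?_⟩
  · have : 0 ≤ (b - a) * k / N := by positivity
    linarith
  · linarith [hz.2]
  · rw [abs_of_nonneg (by linarith)]
    linarith

theorem WithHighProb.of_measureReal {Ω : Type*} [MeasurableSpace Ω] {μ : Measure Ω}
    [IsFiniteMeasure μ] {P : ℕ → Ω → Prop} (f : ℕ → ℝ) (hf : Tendsto f atTop (𝓝 0))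
    (h : ∀ᶠ n in atTop, μ.real {ω | ¬ P n ω} ≤ f n) : WithHighProb μ P := by
  refine .of_le (fun n => ENNReal.ofReal (f n)) (by simpa using ENNReal.tendsto_ofReal hf) ?_
  filter_upwards [h] with n hn
  rw [← ofReal_measureReal]
  exact ENNReal.ofReal_le_ofReal hn

section Uniform

variable {Ω : Type*} [MeasurableSpace Ω] {μ : Measure Ω} [IsProbabilityMeasure μ]
  {PX PR : Measure ℝ} {X R : ℕ → Ω → ℝ} {v : ℝ → ℝ} {l : ℝ}

/-- Markov's inequality with the crude level n²; a fine enough grid makes up for the loss. -/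
theorem IsProductSample.withHighProb_sum_abs_le (hS : IsProductSample μ PX PR X R)
    (hv : Measurable v) (hvi : Integrable v PR) :
    WithHighProb μ fun n ω => ∑ i ∈ Finset.range n, |v (R i ω)| ≤ (n : ℝ) ^ 2 := by
  have hi : ∀ i, Integrable (fun ω => |v (R i ω)|) μ ∧ ∫ ω, |v (R i ω)| ∂μ = ∫ r, |v r| ∂PR := by
    intro i
    have hm : Measurable fun r => |v r| := by fun_prop
    constructor
    · refine (integrable_map_measure (f := R i) (g := fun r => |v r|) hm.aestronglyMeasurable
        (hS.measurable_R i).aemeasurable).1 ?_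
      rw [hS.law_R i]
      exact hvi.abs
    · rw [← hS.law_R i, integral_map (hS.measurable_R i).aemeasurable hm.aestronglyMeasurable]
  refine .of_measureReal (fun n => (∫ r, |v r| ∂PR) / n) (tendsto_const_div_atTop_nhds_zero_nat _) ?_
  filter_upwards [eventually_gt_atTop 0] with n hn
  have hn' : (0 : ℝ) < n := by exact_mod_cast hn
  have hM := mul_meas_ge_le_integral_of_nonneg (μ := μ)
    (f := fun ω => ∑ i ∈ Finset.range n, |v (R i ω)|)
    (ae_of_all _ fun ω => Finset.sum_nonneg fun i _ => abs_nonneg _)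
    (integrable_finsetSum _ fun i _ => (hi i).1) ((n : ℝ) ^ 2)
  rw [integral_finsetSum _ fun i _ => (hi i).1, Finset.sum_congr rfl fun i _ => (hi i).2,
    Finset.sum_const, Finset.card_range, nsmul_eq_mul] at hM
  rw [le_div_iff₀ hn']
  have hmono : μ.real {ω | ¬ ∑ i ∈ Finset.range n, |v (R i ω)| ≤ (n : ℝ) ^ 2} ≤
      μ.real {ω | (n : ℝ) ^ 2 ≤ ∑ i ∈ Finset.range n, |v (R i ω)|} :=
    measureReal_mono fun ω hω => (not_le.1 (Set.mem_ofPred_eq ▸ hω)).le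
  refine le_of_mul_le_mul_left ?_ hn'
  nlinarith

/-- Uniform deviation of weighted sums over a compact interval of weights. -/
theorem IsProductSample.uniform_deviation (hS : IsProductSample μ PX PR X R) (hv : Measurable v)
    (hl : 0 < l) (hint : Integrable (fun r => v r ^ 2 * Real.exp (l * |v r|)) PR)
    {a b : ℝ} (hab : a < b) (hPX : ∀ᵐ x ∂PX, x ∈ Set.Icc a b) {h : ℕ → ℝ} (hh : AssumptionA5 h)
    {w : ℕ → ℝ → ℝ → ℝ} (hw : ∀ n z, Measurable (w n z)) {B C L : ℝ} {A : ℕ} (hB0 : 0 ≤ B)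
    (hL0 : 0 ≤ L)
    (hB : ∀ᶠ n in atTop, ∀ z ∈ Set.Icc a b, ∀ x ∈ Set.Icc a b, |w n z x| ≤ B)
    (hC : ∀ᶠ n in atTop, ∀ z ∈ Set.Icc a b, ∫ x, w n z x ^ 2 ∂PX ≤ C * h n)
    (hL : ∀ᶠ n : ℕ in atTop, ∀ z ∈ Set.Icc a b, ∀ z' ∈ Set.Icc a b, ∀ x ∈ Set.Icc a b,
      |w n z x - w n z' x| ≤ L * n ^ A * |z - z'|) :
    ∃ M, 0 < M ∧ WithHighProb μ fun n ω => ∀ z ∈ Set.Icc a b,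
      |1 / (n * h n) * ∑ i ∈ Finset.range n, w n z (X i ω) * v (R i ω) -
        1 / h n * ((∫ x, w n z x ∂PX) * ∫ r, v r ∂PR)| ≤ M * √(Real.log n / (n * h n)) := by
  have := hS.isProbabilityMeasure_PX
  have := hS.isProbabilityMeasure_PR
  have hvi := integrable_of_integrable_sq_mul_exp hv hl.le hint
  set Cv := ∫ r, v r ^ 2 * Real.exp (l * |v r|) ∂PR
  have hCv : 0 ≤ Cv := integral_nonneg fun r => by positivity
  set mv := ∫ r, v r ∂PR
  set r : ℕ → ℝ := fun n => √(Real.log n / (n * h n))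
  have hr : ∀ n, 0 ≤ r n := fun n => Real.sqrt_nonneg _
  -- The Chernoff exponent is at most (-M₁ + |C| Cv) ln n = -(A + 4) ln n. The union over n^(A+3) +
  -- 1 grid points therefore costs at most 4/n.
  set M₁ := |C| * Cv + A + 4
  have hM₁ : 0 < M₁ := by positivity
  set g : ℕ → ℕ → ℝ := fun n k => a + (b - a) * k / ((n ^ (A + 3) : ℕ) : ℝ)
  set dev : ℕ → ℝ → Ω → ℝ := fun n z ω => ∑ i ∈ Finset.range n, w n z (X i ω) * v (R i ω) -
    n * ((∫ x, w n z x ∂PX) * mv)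
  have hgrid : WithHighProb μ fun n ω => ∀ k ∈ Finset.range (n ^ (A + 3) + 1),
      g n k ∈ Set.Icc a b → |dev n (g n k) ω| ≤ M₁ * (n * h n * r n) := by
    refine .of_measureReal (fun n => 4 / n) (tendsto_const_div_atTop_nhds_zero_nat _) ?_
    have ht0 : ∀ᶠ n in atTop, r n * B ≤ l := by
      have := hh.tendsto_sqrt.mul_const B
      rw [zero_mul] at this
      exact this.eventually_le_const hl
    filter_upwards [eventually_gt_atTop 0, hB, hC, ht0, hh.eventually_mul_sq,
      eventually_one_le_log] with n hn hBn hCn htn hsq hlog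
    have hn' : (1 : ℝ) ≤ n := by exact_mod_cast hn
    have hn0 : (0 : ℝ) < n := by linarith
    have hpt : ∀ k, g n k ∈ Set.Icc a b →
        μ.real {ω | M₁ * (n * h n * r n) < |dev n (g n k) ω|} ≤ 2 * (1 / (n : ℝ) ^ (A + 4)) := by
      intro k hk
      refine (hS.measure_lt_abs_sum_le hv hint (hw n (g n k)) (hPX.mono fun x hx => hBn _ hk x hx)
        hB0 (hr n) htn n _).trans ?_
      have e : (1 / (n : ℝ) ^ (A + 4)) = Real.exp (-((A + 4 : ℕ) * Real.log n)) := by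
        rw [Real.exp_neg, Real.exp_nat_mul, Real.exp_log hn0, one_div]
      rw [e]
      gcongr
      have e1 : -r n * (M₁ * (n * h n * r n)) = -M₁ * Real.log n := by
        rw [← hsq]; ring
      have e2 : n * (r n ^ 2 * ((∫ x, w n (g n k) x ^ 2 ∂PX) * Cv)) ≤ |C| * Cv * Real.log n := by
        have hC' : ∫ x, w n (g n k) x ^ 2 ∂PX ≤ |C| * h n :=
          (hCn _ hk).trans (mul_le_mul_of_nonneg_right (le_abs_self C) (hh.pos n).le)
        calc n * (r n ^ 2 * ((∫ x, w n (g n k) x ^ 2 ∂PX) * Cv))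
            ≤ n * (r n ^ 2 * ((|C| * h n) * Cv)) := by gcongr
          _ = |C| * Cv * (n * h n * r n ^ 2) := by ring
          _ = _ := by rw [hsq]
      change -r n * (M₁ * (n * h n * r n)) + n * (r n ^ 2 * ((∫ x, w n (g n k) x ^ 2 ∂PX) * Cv)) ≤ _
      rw [e1]
      push_cast
      simp only [M₁]
      nlinarith
    have hsub : {ω | ¬ ∀ k ∈ Finset.range (n ^ (A + 3) + 1),
        g n k ∈ Set.Icc a b → |dev n (g n k) ω| ≤ M₁ * (n * h n * r n)} ⊆
        ⋃ k ∈ (Finset.range (n ^ (A + 3) + 1)).filter (fun k => g n k ∈ Set.Icc a b),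
          {ω | M₁ * (n * h n * r n) < |dev n (g n k) ω|} := by
      intro ω hω
      rw [Set.mem_ofPred_eq] at hω
      push Not at hω
      obtain ⟨k, hk, hk', hlt⟩ := hω
      exact Set.mem_biUnion (Finset.mem_coe.2 (Finset.mem_filter.2 ⟨hk, hk'⟩)) hlt
    refine (measureReal_mono hsub (measure_ne_top _ _)).trans ((measureReal_biUnion_finset_le _ _).trans ?_)
    refine (Finset.sum_le_card_nsmul _ _ _ fun k hk => hpt k (Finset.mem_filter.1 hk).2).trans ?_
    have hcard : (((Finset.range (n ^ (A + 3) + 1)).filter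
        (fun k => g n k ∈ Set.Icc a b)).card : ℝ) ≤ 2 * (n : ℝ) ^ (A + 3) := by
      have h1 := Finset.card_filter_le (Finset.range (n ^ (A + 3) + 1)) fun k => g n k ∈ Set.Icc a b
      rw [Finset.card_range] at h1
      have h2 : (1 : ℝ) ≤ (n : ℝ) ^ (A + 3) := one_le_pow₀ hn'
      have h3 : (((Finset.range (n ^ (A + 3) + 1)).filter
        (fun k => g n k ∈ Set.Icc a b)).card : ℝ) ≤ (n : ℝ) ^ (A + 3) + 1 := by exact_mod_cast h1
      linarith
    rw [nsmul_eq_mul]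
    refine (mul_le_mul_of_nonneg_right hcard (by positivity)).trans (le_of_eq ?_)
    field_simp
    ring
  have hsum := hS.withHighProb_sum_abs_le hv hvi
  have hae : WithHighProb μ fun (_ : ℕ) ω => ∀ i, X i ω ∈ Set.Icc a b :=
    .of_ae (ae_all_iff.2 fun i => hS.ae_X hPX i)
  refine ⟨M₁ + L * (b - a) + L * (b - a) * |mv|, ?_, ((hgrid.and hsum).and hae).mono ?_⟩
  · have : 0 < b - a := sub_pos.2 hab
    positivity
  filter_upwards [eventually_gt_atTop 0, hB, hL, hh.eventually_inv_le,
    hh.eventually_one_div_le_sqrt] with n hn hBn hLn hinv hone ω hω z hz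
  obtain ⟨⟨hgr, hs⟩, hX⟩ := hω
  have hn' : (1 : ℝ) ≤ n := by exact_mod_cast hn
  have hn0 : (0 : ℝ) < n := by linarith
  have hp := hh.pos n
  have hba : 0 < b - a := sub_pos.2 hab
  obtain ⟨k, hk, hkI, hdist⟩ := exists_grid_point hab (N := n ^ (A + 3)) (by positivity) hz
  have hdevk := hgr k hk hkI
  set z' := g n k
  change |z - z'| ≤ _ at hdist
  change z' ∈ _ at hkI
  -- The mesh makes δ of order n⁻³. After the factor n² from the sum of |v| and 1/(nh) ≤ 1, the
  -- error of passing to the grid is O(1/n).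
  set δ := L * n ^ A * ((b - a) / ((n ^ (A + 3) : ℕ) : ℝ))
  have hδ0 : 0 ≤ δ := by positivity
  have hδ : ∀ x ∈ Set.Icc a b, |w n z x - w n z' x| ≤ δ := fun x hx =>
    (hLn z hz z' hkI x hx).trans (mul_le_mul_of_nonneg_left hdist (by positivity))
  have hδn : δ = L * (b - a) / n ^ 3 := by
    simp only [δ]
    push_cast
    rw [pow_add]
    field_simp
  have h1 : |∑ i ∈ Finset.range n, w n z (X i ω) * v (R i ω) -
      ∑ i ∈ Finset.range n, w n z' (X i ω) * v (R i ω)| ≤ δ * n ^ 2 := by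
    rw [← Finset.sum_sub_distrib]
    refine (Finset.abs_sum_le_sum_abs _ _).trans ?_
    refine (Finset.sum_le_sum (g := fun i => δ * |v (R i ω)|) fun i _ => ?_).trans ?_
    · rw [← sub_mul, abs_mul]
      exact mul_le_mul_of_nonneg_right (hδ _ (hX i)) (abs_nonneg _)
    · rw [← Finset.mul_sum]
      gcongr
  have hwi : ∀ y ∈ Set.Icc a b, Integrable (w n y) PX := fun y hy =>
    integrable_of_ae_bound (hw n y) (hPX.mono fun x hx => hBn y hy x hx)
  have h2 : |(∫ x, w n z x ∂PX) - ∫ x, w n z' x ∂PX| ≤ δ := by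
    rw [← integral_sub (hwi z hz) (hwi z' hkI)]
    have := norm_integral_le_of_norm_le_const (μ := PX) (f := fun x => w n z x - w n z' x) (C := δ)
      (hPX.mono fun x hx => hδ x hx)
    simpa using this
  have h3 : |n * ((∫ x, w n z x ∂PX) * mv) - n * ((∫ x, w n z' x ∂PX) * mv)| ≤ n * (δ * |mv|) := by
    rw [← mul_sub, ← sub_mul, abs_mul, abs_mul, abs_of_pos hn0]
    gcongr
  have hdev : |dev n z ω| ≤ M₁ * (n * h n * r n) + δ * n ^ 2 + n * (δ * |mv|) := by
    have e : dev n z ω = dev n z' ω + (∑ i ∈ Finset.range n, w n z (X i ω) * v (R i ω) -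
      ∑ i ∈ Finset.range n, w n z' (X i ω) * v (R i ω)) -
      (n * ((∫ x, w n z x ∂PX) * mv) - n * ((∫ x, w n z' x ∂PX) * mv)) := by
      simp only [dev]; ring
    rw [e]
    exact (abs_sub _ _).trans (add_le_add ((abs_add_le _ _).trans (add_le_add hdevk h1)) h3)
  have e : 1 / (n * h n) * ∑ i ∈ Finset.range n, w n z (X i ω) * v (R i ω) -
        1 / h n * ((∫ x, w n z x ∂PX) * mv) = 1 / (n * h n) * dev n z ω := by
    simp only [dev]
    field_simp
  rw [e, abs_mul, abs_of_pos (by positivity)]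
  refine (mul_le_mul_of_nonneg_left hdev (by positivity)).trans ?_
  have t1 : 1 / (n * h n) * (M₁ * (n * h n * r n)) = M₁ * r n := by field_simp
  have t2 : 1 / (n * h n) * (δ * n ^ 2) = L * (b - a) * (1 / h n) / n ^ 2 := by
    rw [hδn]; field_simp
  have t3 : 1 / (n * h n) * (n * (δ * |mv|)) = L * (b - a) * |mv| * (1 / h n) / n ^ 3 := by
    rw [hδn]; field_simp
  rw [mul_add, mul_add, t1, t2, t3, add_mul, add_mul]
  have s2 : (1 / h n) / n ^ 2 ≤ r n := by
    refine le_trans ?_ hone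
    rw [div_le_div_iff₀ (by positivity) hn0]
    nlinarith
  have s3 : (1 / h n) / n ^ 3 ≤ r n := by
    have hpow : (n : ℝ) ^ 2 ≤ (n : ℝ) ^ 3 := pow_le_pow_right₀ hn' (by norm_num)
    have hdiv : (1 / h n) / (n : ℝ) ^ 3 ≤ (1 / h n) / (n : ℝ) ^ 2 :=
      div_le_div_of_nonneg_left (by positivity) (by positivity) hpow
    exact hdiv.trans s2
  have q2 : L * (b - a) * (1 / h n) / n ^ 2 ≤ L * (b - a) * r n := by
    rw [mul_div_assoc]
    exact mul_le_mul_of_nonneg_left s2 (by positivity)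
  have q3 : L * (b - a) * |mv| * (1 / h n) / n ^ 3 ≤ L * (b - a) * |mv| * r n := by
    rw [mul_div_assoc]
    exact mul_le_mul_of_nonneg_left s3 (by positivity)
  linarith

end Uniform

/-! ### Logarithmic moments of the Matsuoka distribution -/

section Matsuoka

variable {p : ℝ}

theorem measurable_matsuokaDensity (p : ℝ) : Measurable (matsuokaDensity p) := by
  unfold matsuokaDensity
  exact Measurable.indicator (by fun_prop) measurableSet_Ioo

theorem matsuokaDensity_nonneg (p x : ℝ) : 0 ≤ matsuokaDensity p x :=
  Set.indicator_nonneg (fun x hx => by have := hx.1; positivity) x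

theorem image_exp_neg_Ioi : (fun t : ℝ => Real.exp (-t)) '' Set.Ioi 0 = Set.Ioo 0 1 := by
  ext r
  constructor
  · rintro ⟨t, ht, rfl⟩
    exact ⟨Real.exp_pos _, Real.exp_lt_one_iff.2 (neg_neg_of_pos ht)⟩
  · rintro ⟨h0, h1⟩
    exact ⟨-Real.log r, neg_pos.2 (Real.log_neg h0 h1), by simp [Real.exp_log h0]⟩

theorem hasDerivWithinAt_exp_neg (t : ℝ) (s : Set ℝ) :
    HasDerivWithinAt (fun t : ℝ => Real.exp (-t)) (-Real.exp (-t)) s t := by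
  simpa using (hasDerivAt_neg t).exp.hasDerivWithinAt

/-- The density of the Gamma distribution of `-log R`. -/
noncomputable def gammaWeight (p t : ℝ) : ℝ :=
  2 * √(p ^ 3 / Real.pi) * (t ^ (1 / 2 : ℝ) * Real.exp (-(p * t)))

/-- The substitution r = exp(-t): the Jacobian and r^(p-1) combine to exp(-pt), and √(-ln r) becomes
t^(1/2). -/
theorem abs_exp_neg_smul_matsuokaDensity (hp : 0 < p) (ψ : ℝ → ℝ) {t : ℝ} (ht : t ∈ Set.Ioi 0) :
    |-Real.exp (-t)| • (matsuokaDensity p (Real.exp (-t)) * ψ (Real.exp (-t))) =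
      gammaWeight p t * ψ (Real.exp (-t)) := by
  have ht' : (0 : ℝ) < t := ht
  have hmem : Real.exp (-t) ∈ Set.Ioo (0 : ℝ) 1 :=
    ⟨Real.exp_pos _, Real.exp_lt_one_iff.2 (neg_neg_of_pos ht)⟩
  have e1 : -(p ^ 3) * -t / Real.pi = p ^ 3 / Real.pi * t := by ring
  rw [matsuokaDensity, Set.indicator_of_mem hmem, Real.log_exp, e1,
    Real.sqrt_mul (by positivity), ← Real.exp_mul, abs_neg, abs_of_pos (Real.exp_pos _),
    Real.sqrt_eq_rpow t, smul_eq_mul, gammaWeight]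
  have e2 : Real.exp (-(p * t)) = Real.exp (-t) * Real.exp (-t * (p - 1)) := by
    rw [← Real.exp_add]; congr 1; ring
  rw [e2]
  ring

theorem injOn_exp_neg (s : Set ℝ) : Set.InjOn (fun t : ℝ => Real.exp (-t)) s :=
  fun _ _ _ _ h => neg_injective (Real.exp_injective h)

theorem integrable_matsuoka_iff (hp : 0 < p) (ψ : ℝ → ℝ) :
    Integrable ψ (matsuoka p) ↔
      IntegrableOn (fun t => gammaWeight p t * ψ (Real.exp (-t))) (Set.Ioi 0) := by
  rw [matsuoka, integrable_withDensity_iff_integrable_smul'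
    (measurable_matsuokaDensity p).ennreal_ofReal (ae_of_all _ fun x => ENNReal.ofReal_lt_top)]
  simp only [ENNReal.toReal_ofReal (matsuokaDensity_nonneg _ _), smul_eq_mul]
  have hsupp : Function.support (fun x => matsuokaDensity p x * ψ x) ⊆ Set.Ioo 0 1 := fun x hx => by
    by_contra h
    exact hx (by simp [matsuokaDensity, Set.indicator_of_notMem h])
  rw [← integrableOn_iff_integrable_of_support_subset hsupp, ← image_exp_neg_Ioi,
    integrableOn_image_iff_integrableOn_abs_deriv_smul measurableSet_Ioi
      (fun t _ => hasDerivWithinAt_exp_neg t _) (injOn_exp_neg _)]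
  exact integrableOn_congr_fun (fun t ht => abs_exp_neg_smul_matsuokaDensity hp ψ ht)
    measurableSet_Ioi

theorem integral_matsuoka (hp : 0 < p) (ψ : ℝ → ℝ) :
    ∫ r, ψ r ∂(matsuoka p) = ∫ t in Set.Ioi 0, gammaWeight p t * ψ (Real.exp (-t)) := by
  rw [matsuoka, integral_withDensity_eq_integral_toReal_smul
    (measurable_matsuokaDensity p).ennreal_ofReal (ae_of_all _ fun x => ENNReal.ofReal_lt_top)]
  simp only [ENNReal.toReal_ofReal (matsuokaDensity_nonneg _ _), smul_eq_mul]
  have hzero : ∀ x ∉ Set.Ioo (0 : ℝ) 1, matsuokaDensity p x * ψ x = 0 := fun x h => by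
    simp [matsuokaDensity, Set.indicator_of_notMem h]
  rw [← setIntegral_eq_integral_of_forall_compl_eq_zero hzero, ← image_exp_neg_Ioi,
    integral_image_eq_integral_abs_deriv_smul measurableSet_Ioi
      (fun t _ => hasDerivWithinAt_exp_neg t _) (injOn_exp_neg _)]
  exact setIntegral_congr_fun measurableSet_Ioi
    (fun t ht => abs_exp_neg_smul_matsuokaDensity hp ψ ht)

theorem integral_neg_log_pow_matsuoka (hp : 0 < p) (k : ℕ) :
    ∫ r, (-Real.log r) ^ k ∂(matsuoka p) =
      2 * √(p ^ 3 / Real.pi) * ((1 / p) ^ (k + 3 / 2 : ℝ) * Real.Gamma (k + 3 / 2)) := by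
  rw [integral_matsuoka hp, ← Real.integral_rpow_mul_exp_neg_mul_Ioi (by positivity) hp,
    ← integral_const_mul]
  refine setIntegral_congr_fun measurableSet_Ioi fun t ht => ?_
  have ht' : (0 : ℝ) < t := ht
  simp only [gammaWeight, Real.log_exp, neg_neg]
  have : t ^ (k + 3 / 2 - 1 : ℝ) = t ^ k * t ^ (1 / 2 : ℝ) := by
    rw [← Real.rpow_natCast, ← Real.rpow_add ht']; congr 1; ring
  rw [this]
  ring

theorem gammaWeight_const (hp : 0 < p) (k : ℕ) :
    2 * √(p ^ 3 / Real.pi) * (1 / p) ^ (k + 3 / 2 : ℝ) = 2 / √Real.pi / p ^ k := by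
  have e : √(p ^ 3) = p ^ (3 / 2 : ℝ) := by
    rw [Real.sqrt_eq_rpow, ← Real.rpow_natCast, ← Real.rpow_mul hp.le]; norm_num
  rw [Real.sqrt_div (by positivity), e, one_div, Real.inv_rpow hp.le, Real.rpow_add hp,
    Real.rpow_natCast]
  have := Real.rpow_pos_of_pos hp (3 / 2)
  have := Real.sqrt_pos.2 Real.pi_pos
  field_simp

theorem Gamma_three_halves : Real.Gamma (3 / 2) = √Real.pi / 2 := by
  rw [show (3 / 2 : ℝ) = 1 / 2 + 1 by norm_num, Real.Gamma_add_one (by norm_num),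
    Real.Gamma_one_half_eq]
  ring

theorem integral_neg_log_matsuoka (hp : 0 < p) :
    ∫ r, -Real.log r ∂(matsuoka p) = 3 / (2 * p) := by
  have h := integral_neg_log_pow_matsuoka hp 1
  rw [← mul_assoc, gammaWeight_const hp 1] at h
  simp only [pow_one, Nat.cast_one] at h
  rw [h, add_comm, Real.Gamma_add_one (by norm_num), Gamma_three_halves]
  have := Real.sqrt_pos.2 Real.pi_pos
  field_simp

theorem integral_neg_log_sq_matsuoka (hp : 0 < p) :
    ∫ r, (-Real.log r) ^ 2 ∂(matsuoka p) = 15 / (4 * p ^ 2) := by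
  have h := integral_neg_log_pow_matsuoka hp 2
  rw [← mul_assoc, gammaWeight_const hp 2] at h
  rw [h, show ((2 : ℕ) + 3 / 2 : ℝ) = (3 / 2 + 1) + 1 by norm_num, Real.Gamma_add_one (by norm_num),
    Real.Gamma_add_one (by norm_num), Gamma_three_halves]
  have := Real.sqrt_pos.2 Real.pi_pos
  field_simp
  norm_num

/-- The Gamma tail decays at rate p, so the exponent p/2 still leaves exp(-pt/2). -/
theorem integrable_exp_neg_log_matsuoka (hp : 0 < p) :
    Integrable (fun r => Real.exp (p / 2 * -Real.log r)) (matsuoka p) := by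
  rw [integrable_matsuoka_iff hp]
  have h := (integrableOn_rpow_mul_exp_neg_mul_rpow (s := 1 / 2) (p := 1) (b := p / 2)
    (by norm_num) one_pos (by positivity)).const_mul (2 * √(p ^ 3 / Real.pi))
  refine (integrableOn_congr_fun (fun t ht => ?_) measurableSet_Ioi).1 h
  simp only [gammaWeight, Real.log_exp, neg_neg, Real.rpow_one]
  have e : Real.exp (-(p / 2) * t) = Real.exp (-(p * t)) * Real.exp (p / 2 * t) := by
    rw [← Real.exp_add]; congr 1; ring
  rw [e]
  ring

theorem ae_matsuoka_mem (p : ℝ) : ∀ᵐ r ∂(matsuoka p), r ∈ Set.Ioo (0 : ℝ) 1 := by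
  rw [matsuoka, ae_withDensity_iff (measurable_matsuokaDensity p).ennreal_ofReal]
  refine ae_of_all _ fun r hr => ?_
  by_contra h
  exact hr (by simp [matsuokaDensity, Set.indicator_of_notMem h])

/-- The centred logarithmic inefficiency `-log R - E(-log R)`. -/
noncomputable def logNoise (p r : ℝ) : ℝ := -Real.log r - 3 / (2 * p)

theorem measurable_logNoise (p : ℝ) : Measurable (logNoise p) := by
  unfold logNoise
  fun_prop

theorem abs_logNoise_le (hp : 0 < p) {r : ℝ} (hr : r ∈ Set.Ioo (0 : ℝ) 1) :
    |logNoise p r| ≤ -Real.log r + 3 / (2 * p) := by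
  have h := Real.log_neg hr.1 hr.2
  have h' : 0 < 3 / (2 * p) := by positivity
  rw [logNoise, abs_le]
  constructor <;> linarith

theorem integrable_exp_abs_logNoise (hp : 0 < p) :
    Integrable (fun r => Real.exp (p / 2 * |logNoise p r|)) (matsuoka p) := by
  have hm := measurable_logNoise p
  refine ((integrable_exp_neg_log_matsuoka hp).mul_const (Real.exp (p / 2 * (3 / (2 * p))))).mono'
    (by fun_prop) ?_
  filter_upwards [ae_matsuoka_mem p] with r hr
  rw [Real.norm_eq_abs, abs_of_pos (Real.exp_pos _), ← Real.exp_add, ← mul_add]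
  exact Real.exp_le_exp.2 (mul_le_mul_of_nonneg_left (abs_logNoise_le hp hr) (by positivity))

theorem integrable_abs_logNoise_pow (hp : 0 < p) (k : ℕ) :
    Integrable (fun r => |logNoise p r| ^ k) (matsuoka p) := by
  have hm := measurable_logNoise p
  refine ((integrable_exp_abs_logNoise hp).const_mul (k.factorial / (p / 2) ^ k)).mono'
    (by fun_prop) (ae_of_all _ fun r => ?_)
  have h := Real.pow_div_factorial_le_exp (p / 2 * |logNoise p r|) (by positivity) k
  rw [Real.norm_eq_abs, abs_of_nonneg (by positivity), div_mul_eq_mul_div,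
    le_div_iff₀ (by positivity)]
  rw [div_le_iff₀ (by positivity), mul_pow] at h
  linarith

theorem integrable_logNoise_sq_mul_exp (hp : 0 < p) :
    Integrable (fun r => logNoise p r ^ 2 * Real.exp (p / 4 * |logNoise p r|)) (matsuoka p) := by
  have hm := measurable_logNoise p
  refine ((integrable_exp_abs_logNoise hp).const_mul (2 / (p / 4) ^ 2)).mono'
    (by fun_prop) (ae_of_all _ fun r => ?_)
  have h := Real.pow_div_factorial_le_exp (p / 4 * |logNoise p r|) (by positivity) 2
  -- One half of the exponent p/2 absorbs the square, the other half is the exponential factor kept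
  -- in the statement.
  have e : Real.exp (p / 2 * |logNoise p r|) =
      Real.exp (p / 4 * |logNoise p r|) * Real.exp (p / 4 * |logNoise p r|) := by
    rw [← Real.exp_add]; congr 1; ring
  rw [Real.norm_eq_abs, abs_of_nonneg (by positivity), e, ← mul_assoc]
  gcongr
  rw [mul_pow, sq_abs, Nat.factorial_two, Nat.cast_two, div_le_iff₀ (by positivity)] at h
  rw [div_mul_eq_mul_div, le_div_iff₀ (by positivity)]
  linarith

theorem integrable_logNoise (hp : 0 < p) : Integrable (logNoise p) (matsuoka p) :=
  (integrable_abs_logNoise_pow hp 1).mono' (measurable_logNoise p).aestronglyMeasurable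
    (ae_of_all _ fun r => by simp)

theorem integral_logNoise (hp : 0 < p) [IsProbabilityMeasure (matsuoka p)] :
    ∫ r, logNoise p r ∂(matsuoka p) = 0 := by
  have hi : Integrable (fun r => -Real.log r) (matsuoka p) := by
    refine ((integrable_logNoise hp).add (integrable_const (3 / (2 * p)))).congr
      (ae_of_all _ fun r => ?_)
    simp [logNoise]
  simp only [logNoise]
  rw [integral_sub hi (integrable_const _), integral_neg_log_matsuoka hp]
  simp

/-- The variance 15/(4p²) - (3/(2p))². It determines p as √(3/(2σ²)), which is the relation that
`pHat` inverts. -/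
theorem integral_logNoise_sq (hp : 0 < p) [IsProbabilityMeasure (matsuoka p)] :
    ∫ r, logNoise p r ^ 2 ∂(matsuoka p) = 3 / (2 * p ^ 2) := by
  have i1 := (integrable_logNoise hp).const_mul (3 / p)
  have i2 : Integrable (fun r => logNoise p r ^ 2) (matsuoka p) := by
    simpa using integrable_abs_logNoise_pow hp 2
  have h := integral_neg_log_sq_matsuoka hp
  have e : (fun r => (-Real.log r) ^ 2) =
      fun r => (logNoise p r ^ 2 + 3 / p * logNoise p r) + (3 / (2 * p)) ^ 2 := by
    ext r
    simp only [logNoise]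
    field_simp
    ring
  have hs := integral_add (f := fun r => logNoise p r ^ 2 + 3 / p * logNoise p r)
    (i2.add i1) (integrable_const ((3 / (2 * p)) ^ 2))
  rw [e, hs, integral_add i2 i1, integral_const_mul, integral_logNoise hp, integral_const,
    probReal_univ, one_smul, mul_zero, add_zero] at h
  rw [eq_sub_of_add_eq h]
  field_simp
  norm_num

end Matsuoka

/-! ### Algebra of the local linear estimator -/

section LocalLinear

/-- Cramer's rule for the 2 × 2 normal equations. It also covers a singular matrix, as both the
matrix inverse and the scalar inverse then give 0. -/
theorem localLinear_eq {n : ℕ} (K : ℝ → ℝ) (h : ℝ) (x y : Fin n → ℝ) (z : ℝ) (s : ℕ → ℝ)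
    (hs : s = fun j => ∑ i, 1 / h * K ((x i - z) / h) * (x i - z) ^ j) :
    localLinear K h x y z = (s 0 * s 2 - s 1 ^ 2)⁻¹ *
      (s 2 * (∑ i, 1 / h * K ((x i - z) / h) * y i) -
        s 1 * ∑ i, 1 / h * K ((x i - z) / h) * (x i - z) * y i) := by
  have hm : (designMatrix x z).transpose * weightMatrix K h x z * designMatrix x z =
      !![s 0, s 1; s 1, s 2] := by
    ext i j
    rw [Matrix.mul_apply]
    simp only [weightMatrix, Matrix.mul_diagonal, Matrix.transpose_apply, designMatrix, hs]
    fin_cases i <;> fin_cases j <;>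
      simp only [Matrix.of_apply, Fin.zero_eta, Fin.mk_one, Matrix.cons_val_zero,
        Matrix.cons_val_one, Matrix.cons_val_fin_one] <;>
      exact Finset.sum_congr rfl fun i _ => by ring
  have hv : ((designMatrix x z).transpose * weightMatrix K h x z).mulVec y =
      ![∑ i, 1 / h * K ((x i - z) / h) * y i,
        ∑ i, 1 / h * K ((x i - z) / h) * (x i - z) * y i] := by
    ext i
    simp only [Matrix.mulVec, dotProduct, weightMatrix, Matrix.mul_diagonal, Matrix.transpose_apply,
      designMatrix]
    fin_cases i <;>
      simp only [Matrix.of_apply, Fin.zero_eta, Fin.mk_one, Matrix.cons_val_zero,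
        Matrix.cons_val_one, Matrix.cons_val_fin_one] <;>
      exact Finset.sum_congr rfl fun i _ => by ring
  rw [localLinear, hm, Matrix.mul_assoc, ← Matrix.mulVec_mulVec, hv, Matrix.inv_def,
    Matrix.adjugate_fin_two, Matrix.det_fin_two]
  generalize (∑ i, 1 / h * K ((x i - z) / h) * y i) = τ0
  generalize (∑ i, 1 / h * K ((x i - z) / h) * (x i - z) * y i) = τ1
  simp only [Matrix.mulVec, dotProduct, Fin.sum_univ_two, Matrix.smul_apply, smul_eq_mul,
    Matrix.of_apply, Matrix.cons_val_zero, Matrix.cons_val_one, Matrix.cons_val_fin_one,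
    Ring.inverse_eq_inv']
  ring

/-- Error of the local linear fit against an arbitrary affine function. -/
theorem localLinear_sub_eq {n : ℕ} (K : ℝ → ℝ) {h c : ℝ} (hh : h ≠ 0) (hc : c ≠ 0)
    (x y : Fin n → ℝ) (z α β : ℝ) (S T : ℕ → ℝ)
    (hS : S = fun j => c * ∑ i, ((x i - z) / h) ^ j * K ((x i - z) / h))
    (hT : T = fun j => c * ∑ i, ((x i - z) / h) ^ j * K ((x i - z) / h) *
      (y i - α - β * (x i - z)))
    (hD : S 0 * S 2 - S 1 ^ 2 ≠ 0) :
    localLinear K h x y z - α = (S 2 * T 0 - S 1 * T 1) / (S 0 * S 2 - S 1 ^ 2) := by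
  set s : ℕ → ℝ := fun j => ∑ i, 1 / h * K ((x i - z) / h) * (x i - z) ^ j with hs
  have hSs : ∀ j, S j = c * h / h ^ j * s j := fun j => by
    simp only [hS, hs, Finset.mul_sum]
    refine Finset.sum_congr rfl fun i _ => ?_
    rw [div_pow]
    field_simp
  -- The fit reproduces affine functions: in S₂T₀ - S₁T₁ the β terms cancel and the α terms add up
  -- to -α times the determinant. The factors c and h^j only normalise and drop out of the quotient.
  have hτ : ∀ j, T j = c * h / h ^ j * (∑ i, 1 / h * K ((x i - z) / h) * (x i - z) ^ j * y i
      - α * s j - β * s (j + 1)) := fun j => by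
    simp only [hT, hs, Finset.mul_sum, ← Finset.sum_sub_distrib]
    refine Finset.sum_congr rfl fun i _ => ?_
    rw [div_pow]
    field_simp
    ring
  rw [localLinear_eq K h x y z s hs]
  have h0 := hSs 0
  have h1 := hSs 1
  have h2 := hSs 2
  have t0 := hτ 0
  have t1 := hτ 1
  simp only [pow_zero, pow_one, mul_one, zero_add, div_one, one_add_one_eq_two] at h0 h1 h2 t0 t1
  have hdet : S 0 * S 2 - S 1 ^ 2 = c ^ 2 * (s 0 * s 2 - s 1 ^ 2) := by
    rw [h0, h1, h2]; field_simp
  have hd : s 0 * s 2 - s 1 ^ 2 ≠ 0 := fun h => hD (by rw [hdet, h, mul_zero])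
  rw [hdet, h1, h2, t0, t1, eq_div_iff (mul_ne_zero (pow_ne_zero 2 hc) hd)]
  generalize (∑ i, 1 / h * K ((x i - z) / h) * y i) = τ0
  generalize (∑ i, 1 / h * K ((x i - z) / h) * (x i - z) * y i) = τ1
  field_simp
  ring

end LocalLinear

/-! ### Lipschitz dependence of the weights on the location -/

section Kernel

variable {K : ℝ → ℝ}

/-- The function u^j K(u) need not be globally Lipschitz. A constant growing polynomially in U is
enough, because rescaled points of the support stay below a multiple of n. -/
theorem abs_pow_mul_sub_le {κ Q U : ℝ} (hκ : ∀ u u', |K u - K u'| ≤ κ * |u - u'|)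
    (hQ : ∀ u, |K u| ≤ Q) (hU : 1 ≤ U) {u u' : ℝ} (hu : |u| ≤ U) (hu' : |u'| ≤ U) (j : ℕ) :
    |u ^ j * K u - u' ^ j * K u'| ≤ (j * Q + κ) * U ^ j * |u - u'| := by
  have e : u ^ j * K u - u' ^ j * K u' = (u ^ j - u' ^ j) * K u + u' ^ j * (K u - K u') := by ring
  have hQ0 : 0 ≤ Q := (abs_nonneg _).trans (hQ 0)
  have h1 : |(u ^ j - u' ^ j) * K u| ≤ (|u - u'| * j * U ^ j) * Q := by
    rw [abs_mul]
    refine mul_le_mul ((abs_pow_sub_pow_le u u' j).trans ?_) (hQ u) (abs_nonneg _) (by positivity)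
    gcongr ?_ * _ * ?_
    exact (pow_le_pow_left₀ (by positivity) (max_le hu hu') _).trans
      (pow_le_pow_right₀ hU (Nat.sub_le _ _))
  have h2 : |u' ^ j * (K u - K u')| ≤ U ^ j * (κ * |u - u'|) := by
    rw [abs_mul, abs_pow]
    exact mul_le_mul (pow_le_pow_left₀ (abs_nonneg _) hu' _) (hκ u u') (abs_nonneg _) (by positivity)
  rw [e]
  refine (abs_add_le _ _).trans ((add_le_add h1 h2).trans (le_of_eq (by ring)))

theorem abs_div_le_of_mem_Icc {a b x z h N : ℝ} (hx : x ∈ Set.Icc a b) (hz : z ∈ Set.Icc a b)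
    (hh : 0 < h) (hN : 1 / h ≤ N) : |(x - z) / h| ≤ (1 + (b - a)) * N := by
  have h1 : |x - z| ≤ b - a := abs_sub_le_of_le_of_le hx.1 hx.2 hz.1 hz.2
  have h2 : 0 ≤ b - a := (abs_nonneg _).trans h1
  rw [abs_div, abs_of_pos hh, div_eq_mul_one_div]
  refine mul_le_mul (by linarith) hN (by positivity) (by linarith)

/-- Polynomial Lipschitz bound in the location of the rescaled kernel weights. -/
theorem abs_weight_sub_le {κ Q : ℝ} (hκ0 : 0 ≤ κ) (hκ : ∀ u u', |K u - K u'| ≤ κ * |u - u'|)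
    (hQ : ∀ u, |K u| ≤ Q) {a b h N x z z' : ℝ} (hx : x ∈ Set.Icc a b) (hz : z ∈ Set.Icc a b)
    (hz' : z' ∈ Set.Icc a b) (hh : 0 < h) (hN : 1 / h ≤ N) (hN1 : 1 ≤ N) (j : ℕ) :
    |((x - z) / h) ^ j * K ((x - z) / h) - ((x - z') / h) ^ j * K ((x - z') / h)| ≤
      (j * Q + κ) * (1 + (b - a)) ^ j * N ^ (j + 1) * |z - z'| := by
  have hba : a ≤ b := hx.1.trans hx.2
  have hQ0 : 0 ≤ Q := (abs_nonneg _).trans (hQ 0)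
  have hU : 1 ≤ (1 + (b - a)) * N := by nlinarith
  refine (abs_pow_mul_sub_le hκ hQ hU (abs_div_le_of_mem_Icc hx hz hh hN)
    (abs_div_le_of_mem_Icc hx hz' hh hN) j).trans ?_
  have e : |(x - z) / h - (x - z') / h| ≤ N * |z - z'| := by
    rw [← sub_div, abs_div, abs_of_pos hh, div_eq_mul_one_div, mul_comm, sub_sub_sub_cancel_left,
      abs_sub_comm z' z]
    gcongr
  calc _ ≤ (j * Q + κ) * ((1 + (b - a)) * N) ^ j * (N * |z - z'|) := by gcongr
    _ = _ := by rw [mul_pow]; ring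

end Kernel

/-! ### Expectations of kernel weights under the input law -/

section Moments

variable {a b : ℝ} {fX : ℝ → ℝ}

theorem integral_comp_sub_div (φ : ℝ → ℝ) (z : ℝ) {h : ℝ} (hh : 0 < h) :
    ∫ x, φ ((x - z) / h) = h * ∫ u, φ u := by
  rw [integral_sub_right_eq_self (fun x => φ (x / h)) z, Measure.integral_comp_div φ h,
    abs_of_pos hh, smul_eq_mul]

theorem integrable_comp_sub_div {φ : ℝ → ℝ} (hφ : Integrable φ) (z : ℝ) {h : ℝ} (hh : 0 < h) :
    Integrable fun x => φ ((x - z) / h) :=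
  (hφ.comp_div hh.ne').comp_sub_right z

theorem integral_inputLaw (hm : Measurable fX) (h0 : ∀ x, 0 ≤ fX x) (ψ : ℝ → ℝ) :
    ∫ x, ψ x ∂(volume.withDensity fun x => ENNReal.ofReal (fX x)) = ∫ x, fX x * ψ x := by
  rw [integral_withDensity_eq_integral_toReal_smul hm.ennreal_ofReal
    (ae_of_all _ fun x => ENNReal.ofReal_lt_top)]
  simp only [ENNReal.toReal_ofReal (h0 _), smul_eq_mul]

theorem ae_inputLaw_mem (hm : Measurable fX) (hs : ∀ x, x ∉ Set.Icc a b → fX x = 0) :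
    ∀ᵐ x ∂(volume.withDensity fun x => ENNReal.ofReal (fX x)), x ∈ Set.Icc a b := by
  rw [ae_withDensity_iff hm.ennreal_ofReal]
  refine ae_of_all _ fun x hx => ?_
  by_contra h
  exact hx (by simp [hs x h])

theorem integral_inputLaw_kernel_le (hm : Measurable fX) (h0 : ∀ x, 0 ≤ fX x) {C : ℝ}
    (hC : ∀ x, fX x ≤ C) {φ : ℝ → ℝ} (hφ0 : ∀ u, 0 ≤ φ u) (hφ : Integrable φ) (z : ℝ) {h : ℝ}
    (hh : 0 < h) :
    ∫ x, φ ((x - z) / h) ∂(volume.withDensity fun x => ENNReal.ofReal (fX x)) ≤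
      C * (∫ u, φ u) * h := by
  rw [integral_inputLaw hm h0]
  refine (integral_mono_of_nonneg (ae_of_all _ fun x => mul_nonneg (h0 x) (hφ0 _))
    ((integrable_comp_sub_div hφ z hh).const_mul C)
    (ae_of_all _ fun x => mul_le_mul_of_nonneg_right (hC x) (hφ0 _))).trans (le_of_eq ?_)
  rw [integral_const_mul, integral_comp_sub_div φ z hh]
  ring

theorem setIntegral_comp_sub_div (φ : ℝ → ℝ) (z : ℝ) {h : ℝ} (hh : 0 < h) :
    ∫ x in Set.Icc a b, φ ((x - z) / h) = h * ∫ u in Set.Icc (-((z - a) / h)) ((b - z) / h), φ u := by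
  rw [← integral_indicator measurableSet_Icc, ← integral_indicator measurableSet_Icc,
    ← integral_comp_sub_div _ z hh]
  congr 1 with x
  have hiff : x ∈ Set.Icc a b ↔ (x - z) / h ∈ Set.Icc (-((z - a) / h)) ((b - z) / h) := by
    rw [Set.mem_Icc, Set.mem_Icc, ← neg_div, div_le_div_iff_of_pos_right hh,
      div_le_div_iff_of_pos_right hh]
    constructor <;> rintro ⟨h1, h2⟩ <;> constructor <;> linarith
  by_cases hx : x ∈ Set.Icc a b
  · rw [Set.indicator_of_mem hx, Set.indicator_of_mem (hiff.1 hx)]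
  · rw [Set.indicator_of_notMem hx, Set.indicator_of_notMem fun h' => hx (hiff.2 h')]

/-- Freezing fX at z costs L|x - z| = L h|u| inside the support. Order h is enough here, since these
moments only control the denominator and the size of the coefficients, not the bias. Keeping the
truncated domain makes the bound uniform up to the end points. -/
theorem abs_integral_inputLaw_sub_le (hm : Measurable fX) (h0 : ∀ x, 0 ≤ fX x)
    (hs : ∀ x, x ∉ Set.Icc a b → fX x = 0) {C L : ℝ} (hC : ∀ x, fX x ≤ C) (hL0 : 0 ≤ L)
    (hL : ∀ z ∈ Set.Icc a b, ∀ x ∈ Set.Icc a b, |fX x - fX z| ≤ L * |x - z|)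
    {φ : ℝ → ℝ} (hφ : Integrable φ) (hφ1 : Integrable fun u => |u| * |φ u|) {z h : ℝ}
    (hz : z ∈ Set.Icc a b) (hh : 0 < h) :
    |1 / h * (∫ x, φ ((x - z) / h) ∂(volume.withDensity fun x => ENNReal.ofReal (fX x))) -
      fX z * ∫ u in Set.Icc (-((z - a) / h)) ((b - z) / h), φ u| ≤ L * (∫ u, |u| * |φ u|) * h := by
  have hi := integrable_comp_sub_div hφ z hh
  have hi1 := integrable_comp_sub_div hφ1 z hh
  have hzero : ∀ x ∉ Set.Icc a b, fX x * φ ((x - z) / h) = 0 := fun x hx => by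
    rw [hs x hx, zero_mul]
  have hif : Integrable fun x => fX x * φ ((x - z) / h) :=
    hi.bdd_mul (c := C) hm.aestronglyMeasurable (ae_of_all _ fun x => by
      rw [Real.norm_eq_abs, abs_of_nonneg (h0 x)]; exact hC x)
  have e : (∫ x, fX x * φ ((x - z) / h)) - fX z * (h * ∫ u in Set.Icc (-((z - a) / h)) ((b - z) / h), φ u)
      = ∫ x in Set.Icc a b, (fX x - fX z) * φ ((x - z) / h) := by
    rw [← setIntegral_comp_sub_div φ z hh, ← setIntegral_eq_integral_of_forall_compl_eq_zero hzero,
      ← integral_const_mul, ← integral_sub hif.integrableOn (hi.const_mul _).integrableOn]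
    simp only [sub_mul]
  have hb : |∫ x in Set.Icc a b, (fX x - fX z) * φ ((x - z) / h)| ≤
      L * h * (h * ∫ u, |u| * |φ u|) := by
    have hg : Integrable fun x => L * h * (|(x - z) / h| * |φ ((x - z) / h)|) := hi1.const_mul (L * h)
    have hpt : ∀ᵐ x ∂(volume.restrict (Set.Icc a b)), ‖(fX x - fX z) * φ ((x - z) / h)‖ ≤
        L * h * (|(x - z) / h| * |φ ((x - z) / h)|) := by
      filter_upwards [ae_restrict_mem measurableSet_Icc] with x hx
      have := hL z hz x hx
      rw [Real.norm_eq_abs, abs_mul, abs_div, abs_of_pos hh]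
      calc _ ≤ L * |x - z| * |φ ((x - z) / h)| := by gcongr
        _ = _ := by field_simp
    rw [← integral_comp_sub_div (fun u => |u| * |φ u|) z hh, ← integral_const_mul]
    refine (norm_integral_le_of_norm_le hg.integrableOn hpt).trans
      (setIntegral_le_integral hg (ae_of_all _ fun x => ?_))
    simp only [Pi.zero_apply]
    positivity
  rw [integral_inputLaw hm h0]
  have e2 : 1 / h * (∫ x, fX x * φ ((x - z) / h)) -
      fX z * ∫ u in Set.Icc (-((z - a) / h)) ((b - z) / h), φ u = 1 / h *
      ((∫ x, fX x * φ ((x - z) / h)) - fX z * (h * ∫ u in Set.Icc (-((z - a) / h)) ((b - z) / h), φ u)) := by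
    field_simp
  rw [e2, e, abs_mul, abs_of_pos (by positivity)]
  refine (mul_le_mul_of_nonneg_left hb (by positivity)).trans (le_of_eq ?_)
  field_simp

end Moments

/-! ### Uniform bounds for the sums in the local linear fit -/

section Deviations

variable {Ω : Type*} [MeasurableSpace Ω] {μ : Measure Ω} [IsProbabilityMeasure μ]
  {PR : Measure ℝ} {X R : ℕ → Ω → ℝ} {v fX K : ℝ → ℝ} {a b l : ℝ} {h : ℕ → ℝ}

/-- Used with v = 1 for the design sums and with v = `logNoise p` for the noise sums. As |u|^j|K(u)|
≤ Q for j ≤ 2, the squared weight is at most Q times its absolute value, so its second moment is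
O(h). -/
theorem uniform_deviation_kernel
    (hS : IsProductSample μ (volume.withDensity fun x => ENNReal.ofReal (fX x)) PR X R)
    (hv : Measurable v) (hl : 0 < l)
    (hint : Integrable (fun r => v r ^ 2 * Real.exp (l * |v r|)) PR)
    (hm : Measurable fX) (h0 : ∀ x, 0 ≤ fX x) (hA1 : AssumptionA1 a b fX) {C : ℝ}
    (hC : ∀ x, fX x ≤ C) (hA2 : AssumptionA2 K) (hh : AssumptionA5 h) {j : ℕ} (hj : j ≤ 2) :
    ∃ M, 0 < M ∧ WithHighProb μ fun n ω => ∀ z ∈ Set.Icc a b,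
      |1 / (n * h n) * ∑ i ∈ Finset.range n,
          ((X i ω - z) / h n) ^ j * K ((X i ω - z) / h n) * v (R i ω) -
        1 / h n * ((∫ x, ((x - z) / h n) ^ j * K ((x - z) / h n)
          ∂(volume.withDensity fun x => ENNReal.ofReal (fX x))) * ∫ r, v r ∂PR)| ≤
        M * √(Real.log n / (n * h n)) := by
  obtain ⟨κ, hκ0, hκ⟩ := hA2.exists_lipschitz
  obtain ⟨Q, hQ0, hQ⟩ := hA2.exists_bound
  have hK := hA2.continuous
  have hba : 0 < b - a := sub_pos.2 hA1.lt
  have hprob := hS.isProbabilityMeasure_PX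
  refine hS.uniform_deviation hv hl hint hA1.lt (ae_inputLaw_mem hm hA1.support) hh
    (w := fun n z x => ((x - z) / h n) ^ j * K ((x - z) / h n)) (B := Q)
    (C := Q * (C * ∫ u, |u| ^ j * |K u|)) (L := (j * Q + κ) * (1 + (b - a)) ^ j) (A := j + 1)
    (fun n z => by fun_prop) hQ0 (by positivity) (Eventually.of_forall fun n z _ x _ => ?_)
    (Eventually.of_forall fun n z _ => ?_) ?_
  · rw [abs_mul, abs_pow]
    exact hQ j hj _
  · have hle := integral_inputLaw_kernel_le hm h0 hC (φ := fun u => |u| ^ j * |K u|)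
      (fun u => by positivity) (hA2.integrable_abs (hj.trans (by norm_num))) z (hh.pos n)
    have hi : Integrable (fun x => |(x - z) / h n| ^ j * |K ((x - z) / h n)|)
        (volume.withDensity fun x => ENNReal.ofReal (fX x)) :=
      integrable_of_ae_bound (by fun_prop) (B := Q) (ae_of_all _ fun x => by
        rw [abs_of_nonneg (by positivity)]
        exact hQ j hj _)
    have hmono := integral_mono_of_nonneg (μ := volume.withDensity fun x => ENNReal.ofReal (fX x))
      (f := fun x => (((x - z) / h n) ^ j * K ((x - z) / h n)) ^ 2) (ae_of_all _ fun x => sq_nonneg _)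
      (hi.const_mul Q) (ae_of_all _ fun x => by
        simp only
        rw [← sq_abs, abs_mul, abs_pow, sq]
        exact mul_le_mul_of_nonneg_right (hQ j hj _) (by positivity))
    rw [integral_const_mul] at hmono
    refine hmono.trans ((mul_le_mul_of_nonneg_left hle hQ0).trans (le_of_eq ?_))
    ring
  · filter_upwards [hh.eventually_inv_le, eventually_gt_atTop 0] with n hn hn0 z hz z' hz' x hx
    exact abs_weight_sub_le hκ0 hκ (fun u => by simpa using hQ 0 (by norm_num) u) hx hz hz'
      (hh.pos n) hn (by exact_mod_cast hn0) j

/-- The remainder weights `h² |u|^(j+2) |K u|` sum up to `O(h² + √(ln n / (n h)))`. -/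
theorem uniform_bound_remainder
    (hS : IsProductSample μ (volume.withDensity fun x => ENNReal.ofReal (fX x)) PR X R)
    (hm : Measurable fX) (h0 : ∀ x, 0 ≤ fX x) (hA1 : AssumptionA1 a b fX) {C : ℝ}
    (hC : ∀ x, fX x ≤ C) (hA2 : AssumptionA2 K) (hh : AssumptionA5 h) {j : ℕ} (hj : j ≤ 1) :
    ∃ M, 0 < M ∧ WithHighProb μ fun n ω => ∀ z ∈ Set.Icc a b,
      1 / (n * h n) * ∑ i ∈ Finset.range n,
          h n ^ 2 * |((X i ω - z) / h n) ^ (j + 2) * K ((X i ω - z) / h n)| ≤ M * Frontier.rate h n := by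
  obtain ⟨κ, hκ0, hκ⟩ := hA2.exists_lipschitz
  obtain ⟨Q, hQ0, hQ⟩ := hA2.exists_bound
  have hK := hA2.continuous
  have hba : 0 < b - a := sub_pos.2 hA1.lt
  have hprobX := hS.isProbabilityMeasure_PX
  have hprobR := hS.isProbabilityMeasure_PR
  -- For j = 1 the product |u|³|K(u)| may be unbounded. The extra power is paid by one factor h,
  -- because h|u| = |x - z| ≤ b - a; another factor h is left over and makes the second moment
  -- O(h²).
  have hsize : ∀ n, h n ≤ 1 → ∀ z ∈ Set.Icc a b, ∀ x ∈ Set.Icc a b,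
      |(h n ^ 2 * |((x - z) / h n) ^ (j + 2) * K ((x - z) / h n)|)| ≤ Q * (1 + (b - a)) * h n := by
    intro n hn z hz x hx
    have hp := hh.pos n
    rw [abs_mul, abs_abs, abs_of_nonneg (sq_nonneg _), pow_add, mul_assoc, abs_mul, abs_mul, abs_pow,
      abs_pow]
    have h1 := hQ 2 le_rfl ((x - z) / h n)
    have h2 : h n * |(x - z) / h n| ^ j ≤ 1 + (b - a) := by
      have hx' : |x - z| ≤ b - a := abs_sub_le_of_le_of_le hx.1 hx.2 hz.1 hz.2
      interval_cases j
      · rw [pow_zero, mul_one]; linarith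
      · rw [pow_one, abs_div, abs_of_pos hp, mul_div_cancel₀ _ hp.ne']; linarith
    calc _ = (|(x - z) / h n| ^ 2 * |K ((x - z) / h n)|) * (h n * |(x - z) / h n| ^ j) * h n := by ring
      _ ≤ _ := by gcongr
  obtain ⟨M, hM, hdev⟩ := hS.uniform_deviation (v := fun _ => 1) measurable_const one_pos
    (integrable_const _) hA1.lt
    (ae_inputLaw_mem hm hA1.support) hh
    (w := fun n z x => h n ^ 2 * |((x - z) / h n) ^ (j + 2) * K ((x - z) / h n)|)
    (B := Q * (1 + (b - a))) (C := (Q * (1 + (b - a))) ^ 2)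
    (L := ((j + 2 : ℕ) * Q + κ) * (1 + (b - a)) ^ (j + 2)) (A := j + 2 + 1)
    (fun n z => by fun_prop) (by positivity) (by positivity)
    (by
      filter_upwards [hh.eventually_le_one] with n hn z hz x hx
      refine (hsize n hn z hz x hx).trans (mul_le_of_le_one_right (by positivity) hn))
    (by
      filter_upwards [hh.eventually_le_one] with n hn z hz
      have hp := hh.pos n
      have := norm_integral_le_of_norm_le_const
        (μ := volume.withDensity fun x => ENNReal.ofReal (fX x))
        (f := fun x => (h n ^ 2 * |((x - z) / h n) ^ (j + 2) * K ((x - z) / h n)|) ^ 2)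
        (C := (Q * (1 + (b - a)) * h n) ^ 2) ((ae_inputLaw_mem hm hA1.support).mono fun x hx => by
          rw [Real.norm_eq_abs, abs_pow]
          exact pow_le_pow_left₀ (abs_nonneg _) (hsize n hn z hz x hx) 2)
      rw [probReal_univ, mul_one] at this
      refine ((le_abs_self _).trans this).trans ?_
      rw [mul_pow]
      gcongr
      nlinarith)
    (by
      filter_upwards [hh.eventually_inv_le, eventually_gt_atTop 0, hh.eventually_le_one]
        with n hn hn0 h1 z hz z' hz' x hx
      have hp := hh.pos n
      rw [← mul_sub, abs_mul, abs_of_nonneg (sq_nonneg _)]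
      refine (mul_le_of_le_one_left (abs_nonneg _) (pow_le_one₀ hp.le h1)).trans ?_
      exact (abs_abs_sub_abs_le_abs_sub _ _).trans
        (abs_weight_sub_le hκ0 hκ (fun u => by simpa using hQ 0 (by norm_num) u) hx hz hz'
          hp hn (by exact_mod_cast hn0) (j + 2)))
  have hA0 : 0 ≤ ∫ u, |u| ^ (j + 2) * |K u| := integral_nonneg fun u => by positivity
  have hC0 : 0 ≤ C := (h0 0).trans (hC 0)
  refine ⟨M + C * ∫ u, |u| ^ (j + 2) * |K u|, by positivity, hdev.mono
    (Eventually.of_forall fun n ω hω z hz => ?_)⟩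
  have hp := hh.pos n
  have hdz := (abs_le.1 (hω z hz)).2
  have hmean := integral_inputLaw_kernel_le hm h0 hC (φ := fun u => |u| ^ (j + 2) * |K u|)
      (fun u => by positivity) (hA2.integrable_abs (by linarith)) z hp
  simp only [mul_one, integral_const, probReal_univ, smul_eq_mul, integral_const_mul] at hdz
  simp only [abs_mul, abs_pow] at hdz ⊢
  have hsq := Real.sqrt_nonneg (Real.log n / (n * h n))
  have hmean' : 1 / h n * (h n ^ 2 * ∫ x, |(x - z) / h n| ^ (j + 2) * |K ((x - z) / h n)|
      ∂(volume.withDensity fun x => ENNReal.ofReal (fX x))) ≤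
      (C * ∫ u, |u| ^ (j + 2) * |K u|) * h n ^ 2 := by
    have e : 1 / h n * (h n ^ 2 * ∫ x, |(x - z) / h n| ^ (j + 2) * |K ((x - z) / h n)|
      ∂(volume.withDensity fun x => ENNReal.ofReal (fX x))) =
      h n * ∫ x, |(x - z) / h n| ^ (j + 2) * |K ((x - z) / h n)|
      ∂(volume.withDensity fun x => ENNReal.ofReal (fX x)) := by field_simp
    rw [e]
    refine (mul_le_mul_of_nonneg_left hmean hp.le).trans (le_of_eq (by ring))
  rw [Frontier.rate, add_mul, mul_add, mul_add]
  have p1 : 0 ≤ M * h n ^ 2 := by positivity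
  have p2 : 0 ≤ (C * ∫ u, |u| ^ (j + 2) * |K u|) * √(Real.log n / (n * h n)) := by positivity
  linarith

end Deviations

/-! ### Uniform rate of the local linear estimator -/

section

theorem sqrt_le_rate (h : ℕ → ℝ) (n : ℕ) : √(Real.log n / (n * h n)) ≤ Frontier.rate h n :=
  le_add_of_nonneg_left (sq_nonneg _)

theorem rate_nonneg (h : ℕ → ℝ) (n : ℕ) : 0 ≤ Frontier.rate h n :=
  (Real.sqrt_nonneg _).trans (sqrt_le_rate h n)

/-- Stability of the determinant under entrywise perturbation; 4Q + 2 collects 2Q + 1 from the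
squared entry and (Q + 1) + Q from the product. -/
theorem half_le_abs_det {S₀ S₁ S₂ m₀ m₁ m₂ η Q D : ℝ} (h₀ : |S₀ - m₀| ≤ η) (h₁ : |S₁ - m₁| ≤ η)
    (h₂ : |S₂ - m₂| ≤ η) (q₀ : |m₀| ≤ Q) (q₁ : |m₁| ≤ Q) (q₂ : |m₂| ≤ Q) (hη : η ≤ 1)
    (hD : D ≤ |m₀ * m₂ - m₁ ^ 2|) (hηD : η * (4 * Q + 2) ≤ D / 2) :
    D / 2 ≤ |S₀ * S₂ - S₁ ^ 2| := by
  have hη0 : 0 ≤ η := (abs_nonneg _).trans h₀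
  have hQ0 : 0 ≤ Q := (abs_nonneg _).trans q₀
  have bound : ∀ {S m : ℝ}, |S - m| ≤ η → |m| ≤ Q → |S| ≤ Q + 1 := fun {S m} h q => by
    have := abs_add_le (S - m) m
    rw [sub_add_cancel] at this
    linarith
  have e : (m₀ * m₂ - m₁ ^ 2) - (S₀ * S₂ - S₁ ^ 2) =
      (S₁ - m₁) * (S₁ + m₁) - ((S₀ - m₀) * S₂ + m₀ * (S₂ - m₂)) := by ring
  have b1 : |(S₁ - m₁) * (S₁ + m₁)| ≤ η * (Q + 1 + Q) := by
    rw [abs_mul]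
    exact mul_le_mul h₁ ((abs_add_le _ _).trans (add_le_add (bound h₁ q₁) q₁)) (abs_nonneg _) hη0
  have b2 : |(S₀ - m₀) * S₂| ≤ η * (Q + 1) := by
    rw [abs_mul]
    exact mul_le_mul h₀ (bound h₂ q₂) (abs_nonneg _) hη0
  have b3 : |m₀ * (S₂ - m₂)| ≤ Q * η := by
    rw [abs_mul]
    exact mul_le_mul q₀ h₂ (abs_nonneg _) hQ0
  have hb : |(m₀ * m₂ - m₁ ^ 2) - (S₀ * S₂ - S₁ ^ 2)| ≤ η * (4 * Q + 2) := by
    rw [e]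
    refine (abs_sub _ _).trans ((add_le_add b1 ((abs_add_le _ _).trans (add_le_add b2 b3))).trans
      (le_of_eq (by ring)))
  have := abs_sub_abs_le_abs_sub (m₀ * m₂ - m₁ ^ 2) (S₀ * S₂ - S₁ ^ 2)
  linarith

variable {Ω : Type*} [MeasurableSpace Ω] {μ : Measure Ω} {p a b : ℝ} {f fX K : ℝ → ℝ} {h : ℕ → ℝ}
  {X R Y Z : ℕ → Ω → ℝ}

theorem IsFrontierSample.isProductSample (hs : IsFrontierSample μ p f fX X R Y) :
    IsProductSample μ (volume.withDensity fun x => ENNReal.ofReal (fX x)) (matsuoka p) X R where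
  measurable_X := hs.measurable_X
  measurable_R := hs.measurable_R
  indep_units := hs.indep_units
  indep := hs.indep_input_efficiency
  law_X := hs.law_X
  law_R := hs.law_R

theorem AssumptionA1.exists_upper (hA1 : AssumptionA1 a b fX) : ∃ C, 0 ≤ C ∧ ∀ x, fX x ≤ C := by
  obtain ⟨C, hC⟩ := hA1.upper
  refine ⟨max C 0, le_max_right _ _, fun x => ?_⟩
  by_cases hx : x ∈ Set.Icc a b
  · exact (hC x hx).trans (le_max_left _ _)
  · rw [hA1.support x hx]
    exact le_max_right _ _

/-- On an event of probability one, `Z = g(X) + ε`. -/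
theorem IsFrontierSample.ae_log_model [IsProbabilityMeasure μ] (hf : ∀ x ∈ Set.Icc a b, 0 < f x)
    (hs : IsFrontierSample μ p f fX X R Y) (hZ : ∀ i ω, Z i ω = -Real.log (Y i ω))
    (hA1 : AssumptionA1 a b fX) :
    ∀ᵐ ω ∂μ, ∀ i, X i ω ∈ Set.Icc a b ∧
      Z i ω = regression p f (X i ω) + logNoise p (R i ω) := by
  have hS := hs.isProductSample
  refine ae_all_iff.2 fun i => ?_
  filter_upwards [hS.ae_X (ae_inputLaw_mem hs.measurable_density hA1.support) i,
    hS.ae_R (ae_matsuoka_mem p) i] with ω hX hR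
  refine ⟨hX, ?_⟩
  rw [hZ, hs.model, Real.log_mul (hf _ hX).ne' hR.1.ne', regression, logNoise]
  ring

/-- The local kernel moments stay bounded, and their determinant stays away from zero, uniformly
over the support. -/
theorem exists_local_moments (hA1 : AssumptionA1 a b fX) (h0 : ∀ x, 0 ≤ fX x)
    (hm : Measurable fX) (hLip : ∃ L, 0 ≤ L ∧
      ∀ z ∈ Set.Icc a b, ∀ x ∈ Set.Icc a b, |fX x - fX z| ≤ L * |x - z|)
    (hA2 : AssumptionA2 K) (hK : KernelNondegenerate K) (hh : AssumptionA5 h) :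
    ∃ m : ℕ → ℕ → ℝ → ℝ, ∃ Q D : ℝ, 0 ≤ Q ∧ 0 < D ∧ ∀ᶠ n in atTop, ∀ z ∈ Set.Icc a b,
      (∀ j ≤ 2, |m j n z| ≤ Q ∧
        |1 / h n * (∫ x, ((x - z) / h n) ^ j * K ((x - z) / h n)
          ∂(volume.withDensity fun x => ENNReal.ofReal (fX x))) - m j n z| ≤ Q * h n) ∧
      D ≤ |m 0 n z * m 2 n z - m 1 n z ^ 2| := by
  obtain ⟨L, hL0, hL⟩ := hLip
  obtain ⟨C, hC0, hC⟩ := hA1.exists_upper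
  obtain ⟨c, hc, hlow⟩ := hA1.lower
  obtain ⟨d, T, hd, hdet⟩ := exists_le_abs_det_Icc hA2 hK
  set I : ℕ → ℝ := fun j => ∫ u, |u| ^ j * |K u| with hI
  have hI0 : ∀ j, 0 ≤ I j := fun j => integral_nonneg fun u => by positivity
  set q := C * (I 0 + I 1 + I 2) + L * (I 1 + I 2 + I 3)
  have hIsum : ∀ j ≤ 2, I j ≤ I 0 + I 1 + I 2 ∧ I (j + 1) ≤ I 1 + I 2 + I 3 := by
    intro j hj
    have := hI0 0
    have := hI0 1
    have := hI0 2
    have := hI0 3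
    interval_cases j <;> constructor <;> linarith
  have h012 : 0 ≤ I 0 + I 1 + I 2 := (hI0 0).trans (hIsum 0 (by norm_num)).1
  have h123 : 0 ≤ I 1 + I 2 + I 3 := (hI0 _).trans (hIsum 0 (by norm_num)).2
  have hq : 0 ≤ q := by positivity
  -- The factor fX z pulls out of the determinant as fX z² ≥ c², whence the lower bound c² d.
  refine ⟨fun j n z => fX z * ∫ u in Set.Icc (-((z - a) / h n)) ((b - z) / h n), u ^ j * K u,
    q, c ^ 2 * d, hq, by positivity, ?_⟩
  -- This says that the rescaled support has length at least T, as the uniform determinant bound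
  -- requires.
  have hT : ∀ᶠ n in atTop, T * h n ≤ b - a := by
    have := hh.tendsto.const_mul T
    rw [mul_zero] at this
    exact this.eventually_le_const (sub_pos.2 hA1.lt)
  filter_upwards [hT] with n hTn z hz
  have hp := hh.pos n
  refine ⟨fun j hj => ⟨?_, ?_⟩, ?_⟩
  · rw [abs_mul, abs_of_nonneg (h0 z)]
    have hi := hA2.integrable_pow_mul (hj.trans (by norm_num : 2 ≤ 4))
    have h1 : |∫ u in Set.Icc (-((z - a) / h n)) ((b - z) / h n), u ^ j * K u| ≤ I j := by
      refine abs_integral_le_integral_abs.trans ((setIntegral_le_integral hi.abs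
        (ae_of_all _ fun u => abs_nonneg _)).trans (le_of_eq ?_))
      simp only [hI, abs_mul, abs_pow]
    calc _ ≤ C * (I 0 + I 1 + I 2) :=
          mul_le_mul (hC z) (h1.trans (hIsum j hj).1) (abs_nonneg _) hC0
      _ ≤ q := le_add_of_nonneg_right (by positivity)
  · have e : (fun u : ℝ => |u| * |u ^ j * K u|) = fun u => |u| ^ (j + 1) * |K u| := by
      ext u
      rw [abs_mul, abs_pow]
      ring
    have h1 := abs_integral_inputLaw_sub_le hm h0 hA1.support hC hL0 hL
      (φ := fun u => u ^ j * K u) (hA2.integrable_pow_mul (hj.trans (by norm_num : 2 ≤ 4)))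
      (by rw [e]; exact hA2.integrable_abs (by linarith)) hz hp
    rw [e] at h1
    refine h1.trans (mul_le_mul_of_nonneg_right ?_ hp.le)
    calc _ ≤ L * (I 1 + I 2 + I 3) := mul_le_mul_of_nonneg_left (hIsum j hj).2 hL0
      _ ≤ q := le_add_of_nonneg_left (by positivity)
  · have h1 := hdet ((z - a) / h n) ((b - z) / h n) (div_nonneg (sub_nonneg.2 hz.1) hp.le)
      (div_nonneg (sub_nonneg.2 hz.2) hp.le) (by
        rw [← add_div, le_div_iff₀ hp]; linarith)
    rw [det_kernelMomentMatrix] at h1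
    have hcz := hlow z hz
    have e : ∀ A B E : ℝ, fX z * A * (fX z * B) - (fX z * E) ^ 2 = fX z ^ 2 * (A * B - E ^ 2) := by
      intros; ring
    rw [e, abs_mul, abs_of_nonneg (sq_nonneg _)]
    gcongr

/-- The fit is compared with the Taylor line of g at z. On finitely many likely events the
determinant is at least D/2, the moments S₁ and S₂ are at most Q + 1, and T₀ and T₁ are at most τ
times the rate; the constant is 2(Q + 1)τ/(D/2). -/
theorem localLinear_uniform [IsProbabilityMeasure μ] (hp : 0 < p)
    (hf : ∀ x ∈ Set.Icc a b, 0 < f x) (hs : IsFrontierSample μ p f fX X R Y)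
    (hZ : ∀ i ω, Z i ω = -Real.log (Y i ω)) (hA1 : AssumptionA1 a b fX) (hA2 : AssumptionA2 K)
    (hK : KernelNondegenerate K) (hA4 : AssumptionA4 a b fX (regression p f))
    (hh : AssumptionA5 h) :
    ∃ M, 0 < M ∧ WithHighProb μ fun n ω => ∀ z ∈ Set.Icc a b,
      |localLinear K (h n) (firstObs X n ω) (firstObs Z n ω) z - regression p f z| ≤
        M * Frontier.rate h n := by
  have hS := hs.isProductSample
  have hm := hs.measurable_density
  have h0 := hs.density_nonneg
  have hprobR := hS.isProbabilityMeasure_PR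
  obtain ⟨C, hC0, hC⟩ := hA1.exists_upper
  obtain ⟨G, hG0, hG⟩ := exists_taylor_quotient hA4.density hA4.product hA1.lower
  obtain ⟨m, Q, D, hQ0, hD, hmom⟩ :=
    exists_local_moments hA1 h0 hm hA4.density.lipschitz hA2 hK hh
  have devS := fun j (hj : j ≤ 2) => uniform_deviation_kernel hS (v := fun _ => 1) measurable_const
    one_pos (integrable_const _) hm h0 hA1 hC hA2 hh hj
  obtain ⟨M₀, hM₀, dS₀⟩ := devS 0 (by norm_num)
  obtain ⟨M₁, hM₁, dS₁⟩ := devS 1 (by norm_num)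
  obtain ⟨M₂, hM₂, dS₂⟩ := devS 2 (by norm_num)
  have devT := fun j (hj : j ≤ 2) => uniform_deviation_kernel hS (v := logNoise p)
    (measurable_logNoise p) (by positivity) (integrable_logNoise_sq_mul_exp hp) hm h0 hA1 hC hA2 hh hj
  obtain ⟨N₀, hN₀, dT₀⟩ := devT 0 (by norm_num)
  obtain ⟨N₁, hN₁, dT₁⟩ := devT 1 (by norm_num)
  obtain ⟨B₀, hB₀, dB₀⟩ := uniform_bound_remainder hS hm h0 hA1 hC hA2 hh (j := 0) (by norm_num)
  obtain ⟨B₁, hB₁, dB₁⟩ := uniform_bound_remainder hS hm h0 hA1 hC hA2 hh (j := 1) (by norm_num)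
  set M' := M₀ + M₁ + M₂ with hM'
  set τ := N₀ + N₁ + G * (B₀ + B₁) with hτ
  have hτ0 : 0 < τ := by positivity
  have hη : Tendsto (fun n : ℕ => M' * √(Real.log n / (n * h n)) + Q * h n) atTop (𝓝 0) := by
    simpa using (hh.tendsto_sqrt.const_mul M').add (hh.tendsto.const_mul Q)
  have hη1 := hη.eventually_le_const one_pos
  have hη2 : ∀ᶠ n : ℕ in atTop,
      (M' * √(Real.log n / (n * h n)) + Q * h n) * (4 * Q + 2) ≤ D / 2 := by
    have := hη.mul_const (4 * Q + 2)
    rw [zero_mul] at this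
    exact this.eventually_le_const (half_pos hD)
  refine ⟨2 * (Q + 1) * τ / (D / 2), by positivity,
    (((dS₀.and (dS₁.and dS₂)).and (dT₀.and dT₁)).and ((dB₀.and dB₁).and
      (.of_ae (hs.ae_log_model hf hZ hA1)))).mono ?_⟩
  filter_upwards [hmom, hη1, hη2, eventually_gt_atTop 0] with n hmn hη1n hη2n hn ω hω z hz
  obtain ⟨⟨⟨eS₀, eS₁, eS₂⟩, eT₀, eT₁⟩, ⟨eB₀, eB₁⟩, hmodel⟩ := hω
  have hn0 : (0 : ℝ) < n := by exact_mod_cast hn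
  have hpos := hh.pos n
  have hr0 := Real.sqrt_nonneg (Real.log n / (n * h n))
  have hrρ := sqrt_le_rate h n
  obtain ⟨hmj, hmD⟩ := hmn z hz
  obtain ⟨-, β, hβ⟩ := hG z hz
  set c := 1 / (n * h n)
  have hc : 0 < c := by positivity
  set S : ℕ → ℝ := fun j =>
    c * ∑ i ∈ Finset.range n, ((X i ω - z) / h n) ^ j * K ((X i ω - z) / h n) with hSdef
  set E : ℕ → ℝ := fun j =>
    c * ∑ i ∈ Finset.range n, ((X i ω - z) / h n) ^ j * K ((X i ω - z) / h n) * logNoise p (R i ω)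
  set B : ℕ → ℝ := fun j =>
    c * ∑ i ∈ Finset.range n,
      h n ^ 2 * |((X i ω - z) / h n) ^ (j + 2) * K ((X i ω - z) / h n)|
  set T : ℕ → ℝ := fun j => c * ∑ i ∈ Finset.range n, ((X i ω - z) / h n) ^ j *
    K ((X i ω - z) / h n) * (Z i ω - regression p f z - β * (X i ω - z)) with hTdef
  have hSm : ∀ j ≤ 2, ∀ M ≤ M', |S j - 1 / h n * (∫ x, ((x - z) / h n) ^ j * K ((x - z) / h n)
          ∂(volume.withDensity fun x => ENNReal.ofReal (fX x)))| ≤ M * √(Real.log n / (n * h n)) →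
      |S j - m j n z| ≤ M' * √(Real.log n / (n * h n)) + Q * h n := fun j hj M hMM hdev => by
    refine (abs_sub_le _ _ _).trans (add_le_add (hdev.trans ?_) (hmj j hj).2)
    gcongr
  have t₀ := hSm 0 (by norm_num) M₀ (by linarith) (by
    have := eS₀ z hz
    simp only [mul_one, integral_const, probReal_univ, smul_eq_mul] at this
    exact this)
  have t₁ := hSm 1 (by norm_num) M₁ (by linarith) (by
    have := eS₁ z hz
    simp only [mul_one, integral_const, probReal_univ, smul_eq_mul] at this
    exact this)
  have t₂ := hSm 2 (by norm_num) M₂ (by linarith) (by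
    have := eS₂ z hz
    simp only [mul_one, integral_const, probReal_univ, smul_eq_mul] at this
    exact this)
  have q₀ := (hmj 0 (by norm_num)).1
  have q₁ := (hmj 1 (by norm_num)).1
  have q₂ := (hmj 2 (by norm_num)).1
  have hdet := half_le_abs_det t₀ t₁ t₂ q₀ q₁ q₂ hη1n hmD hη2n
  -- Each response is noise plus Taylor remainder. The latter is at most G(x - z)² = G h²u², which
  -- raises the exponent of the weight from j to j + 2.
  have hTj : ∀ j, |T j| ≤ |E j| + G * B j := fun j => by
    have e : T j = E j + c * ∑ i ∈ Finset.range n, ((X i ω - z) / h n) ^ j * K ((X i ω - z) / h n) *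
        (regression p f (X i ω) - regression p f z - β * (X i ω - z)) := by
      simp only [T, E]
      rw [← mul_add, ← Finset.sum_add_distrib]
      congr 1
      refine Finset.sum_congr rfl fun i _ => ?_
      rw [(hmodel i).2]
      ring
    rw [e]
    refine (abs_add_le _ _).trans (add_le_add le_rfl ?_)
    simp only [B]
    rw [abs_mul, abs_of_pos hc, mul_left_comm]
    refine mul_le_mul_of_nonneg_left ?_ hc.le
    rw [Finset.mul_sum]
    refine (Finset.abs_sum_le_sum_abs _ _).trans (Finset.sum_le_sum fun i _ => ?_)
    rw [abs_mul]
    refine (mul_le_mul_of_nonneg_left (hβ _ (hmodel i).1) (abs_nonneg _)).trans (le_of_eq ?_)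
    rw [pow_add, mul_right_comm _ (((X i ω - z) / h n) ^ 2), abs_mul (_ * _),
      abs_of_nonneg (sq_nonneg ((X i ω - z) / h n)), div_pow]
    field_simp
  -- The noise is centred, so the deviation bound is a bound on the sum itself.
  have hE₀ : |E 0| ≤ N₀ * √(Real.log n / (n * h n)) := by
    have := eT₀ z hz
    rw [integral_logNoise hp, mul_zero, mul_zero, sub_zero] at this
    exact this
  have hE₁ : |E 1| ≤ N₁ * √(Real.log n / (n * h n)) := by
    have := eT₁ z hz
    rw [integral_logNoise hp, mul_zero, mul_zero, sub_zero] at this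
    exact this
  have hb₀ : B 0 ≤ B₀ * Frontier.rate h n := eB₀ z hz
  have hb₁ : B 1 ≤ B₁ * Frontier.rate h n := eB₁ z hz
  have hρ := rate_nonneg h n
  have hT₀ : |T 0| ≤ τ * Frontier.rate h n := by
    have h1 : G * B 0 ≤ G * (B₀ * Frontier.rate h n) := by gcongr
    have h2 : N₀ * √(Real.log n / (n * h n)) ≤ N₀ * Frontier.rate h n := by gcongr
    have h3 : 0 ≤ (N₁ + G * B₁) * Frontier.rate h n := by positivity
    have := hTj 0
    rw [hτ]
    linarith
  have hT₁ : |T 1| ≤ τ * Frontier.rate h n := by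
    have h1 : G * B 1 ≤ G * (B₁ * Frontier.rate h n) := by gcongr
    have h2 : N₁ * √(Real.log n / (n * h n)) ≤ N₁ * Frontier.rate h n := by gcongr
    have h3 : 0 ≤ (N₀ + G * B₀) * Frontier.rate h n := by positivity
    have := hTj 1
    rw [hτ]
    linarith
  have hdet0 : S 0 * S 2 - S 1 ^ 2 ≠ 0 := by
    intro h
    rw [h, abs_zero] at hdet
    linarith
  have hbound : ∀ j ≤ 2, |S j - m j n z| ≤ M' * √(Real.log n / (n * h n)) + Q * h n →
      |S j| ≤ Q + 1 := fun j hj ht => by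
    have := abs_add_le (S j - m j n z) (m j n z)
    rw [sub_add_cancel] at this
    linarith [(hmj j hj).1]
  have hS₁ := hbound 1 (by norm_num) t₁
  have hS₂ := hbound 2 (by norm_num) t₂
  rw [localLinear_sub_eq K hpos.ne' hc.ne' (firstObs X n ω) (firstObs Z n ω) z _ β S T
    (by
      ext j
      rw [hSdef]
      simp only [firstObs]
      rw [Fin.sum_univ_eq_sum_range (fun i => ((X i ω - z) / h n) ^ j * K ((X i ω - z) / h n)) n])
    (by
      ext j
      rw [hTdef]
      simp only [firstObs]
      rw [Fin.sum_univ_eq_sum_range (fun i => ((X i ω - z) / h n) ^ j *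
        K ((X i ω - z) / h n) * (Z i ω - regression p f z - β * (X i ω - z))) n]) hdet0,
    abs_div, div_mul_eq_mul_div]
  refine div_le_div₀ (by positivity) ?_ (by positivity) hdet
  refine (abs_sub _ _).trans ?_
  rw [abs_mul (S 2), abs_mul (S 1)]
  have b₀ := mul_le_mul hS₂ hT₀ (abs_nonneg _) (by positivity)
  have b₁ := mul_le_mul hS₁ hT₁ (abs_nonneg _) (by positivity)
  linarith

end

/-! ### From residuals to the estimators of p and f -/

section

section Deterministic

/-- For q = √(3/(2s)), the bound follows from (q - p)(q + p) = q² - p² and q + p ≥ p. The smallness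
of δ keeps s above half of 3/(2p²), so that p²/s ≤ (4/3)p⁴. -/
theorem abs_sqrt_inv_sub_le {p s δ : ℝ} (hp : 0 < p) (hδ : |s - 3 / (2 * p ^ 2)| ≤ δ)
    (hδ1 : δ ≤ 3 / (4 * p ^ 2)) : |√(3 / (2 * s)) - p| ≤ 4 / 3 * p ^ 3 * δ := by
  have hs : 3 / (4 * p ^ 2) ≤ s := by
    have := (abs_le.1 hδ).1
    have e : 3 / (2 * p ^ 2) - 3 / (4 * p ^ 2) = 3 / (4 * p ^ 2) := by field_simp; norm_num
    linarith
  have hs0 : 0 < s := lt_of_lt_of_le (by positivity) hs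
  have hsq : √(3 / (2 * s)) ^ 2 = 3 / (2 * s) := Real.sq_sqrt (by positivity)
  have h0 := Real.sqrt_nonneg (3 / (2 * s))
  set q := √(3 / (2 * s))
  have e1 : (q - p) * (q + p) = p ^ 2 / s * (3 / (2 * p ^ 2) - s) := by
    have : (q - p) * (q + p) = q ^ 2 - p ^ 2 := by ring
    rw [this, hsq]
    field_simp
  have e2 : |q - p| * (q + p) ≤ 4 / 3 * p ^ 4 * δ := by
    rw [← abs_of_pos (show 0 < q + p by linarith), ← abs_mul, e1, abs_mul, abs_sub_comm,
      abs_of_pos (by positivity)]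
    have : p ^ 2 / s ≤ 4 / 3 * p ^ 4 := by
      rw [div_le_iff₀ hs0]
      rw [div_le_iff₀ (by positivity)] at hs
      nlinarith [sq_nonneg p]
    gcongr
  have e3 : |q - p| * p ≤ 4 / 3 * p ^ 4 * δ :=
    (mul_le_mul_of_nonneg_left (by linarith) (abs_nonneg _)).trans e2
  refine le_of_mul_le_mul_right (e3.trans (le_of_eq ?_)) hp
  ring

theorem abs_div_sub_div_le {p q δ : ℝ} (hp : 0 < p) (hδ : |q - p| ≤ δ) (hδ1 : δ ≤ p / 2) :
    |3 / (2 * q) - 3 / (2 * p)| ≤ 3 / p ^ 2 * δ := by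
  have hq : p / 2 ≤ q := by linarith [(abs_le.1 hδ).1]
  have hq0 : 0 < q := by linarith
  have e : 3 / (2 * q) - 3 / (2 * p) = 3 / (2 * q * p) * (p - q) := by field_simp
  rw [e, abs_mul, abs_sub_comm, abs_of_pos (by positivity)]
  have : 3 / (2 * q * p) ≤ 3 / p ^ 2 := by
    apply div_le_div_of_nonneg_left (by norm_num) (by positivity)
    nlinarith
  gcongr

theorem abs_exp_sub_exp_le {x y B δ : ℝ} (hy : y ≤ B) (hδ : |x - y| ≤ δ) (hδ1 : δ ≤ 1) :
    |Real.exp x - Real.exp y| ≤ 2 * Real.exp B * δ := by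
  have e : Real.exp x - Real.exp y = Real.exp y * (Real.exp (x - y) - 1) := by
    rw [mul_sub, ← Real.exp_add]
    simp
  rw [e, abs_mul, abs_of_pos (Real.exp_pos _)]
  have h1 := Real.abs_exp_sub_one_le (hδ.trans hδ1)
  calc _ ≤ Real.exp B * (2 * δ) :=
        mul_le_mul (Real.exp_le_exp.2 hy) (h1.trans (by linarith)) (abs_nonneg _) (Real.exp_pos _).le
    _ = _ := by ring

/-- Replacing the errors by residuals changes the mean of squares little. -/
theorem abs_mean_sq_sub_le {n : ℕ} (hn : 0 < n) {e d : ℕ → ℝ} {δ : ℝ}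
    (hd : ∀ i, |d i| ≤ δ) :
    |1 / (n : ℝ) * ∑ i ∈ Finset.range n, (e i + d i) ^ 2 -
      1 / (n : ℝ) * ∑ i ∈ Finset.range n, e i ^ 2| ≤
      (1 + 1 / (n : ℝ) * ∑ i ∈ Finset.range n, e i ^ 2) * δ + δ ^ 2 := by
  have hn0 : (0 : ℝ) < n := by exact_mod_cast hn
  have hδ0 : 0 ≤ δ := (abs_nonneg _).trans (hd 0)
  rw [← mul_sub, ← Finset.sum_sub_distrib, abs_mul, abs_of_pos (by positivity)]
  -- The cross term is handled by 2|e| ≤ 1 + e², which leaves only the mean square of the errors to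
  -- control.
  have hpt : ∀ i, |(e i + d i) ^ 2 - e i ^ 2| ≤ (1 + e i ^ 2) * δ + δ ^ 2 := fun i => by
    have e1 : (e i + d i) ^ 2 - e i ^ 2 = 2 * e i * d i + d i ^ 2 := by ring
    rw [e1]
    refine (abs_add_le _ _).trans (add_le_add ?_ ?_)
    · rw [abs_mul, abs_mul, abs_two]
      refine mul_le_mul ?_ (hd i) (abs_nonneg _) (by positivity)
      nlinarith [sq_nonneg (|e i| - 1), sq_abs (e i)]
    · rw [abs_pow]
      exact pow_le_pow_left₀ (abs_nonneg _) (hd i) 2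
  have hsum := (Finset.abs_sum_le_sum_abs _ _).trans
    (Finset.sum_le_sum (s := Finset.range n) fun i _ => hpt i)
  refine (mul_le_mul_of_nonneg_left hsum (by positivity)).trans (le_of_eq ?_)
  rw [Finset.sum_add_distrib, ← Finset.sum_mul, Finset.sum_add_distrib]
  simp only [Finset.sum_const, Finset.card_range, nsmul_eq_mul, mul_one]
  field_simp

end Deterministic

variable {Ω : Type*} [MeasurableSpace Ω] {μ : Measure Ω} {p a b : ℝ} {f fX K : ℝ → ℝ} {h : ℕ → ℝ}
  {X R Y Z : ℕ → Ω → ℝ}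

/-- Chebyshev's inequality for the mean of squared errors. -/
theorem IsProductSample.withHighProb_mean_sq [IsProbabilityMeasure μ] {PX : Measure ℝ} (hp : 0 < p)
    (hS : IsProductSample μ PX (matsuoka p) X R) (hh : AssumptionA5 h) :
    WithHighProb μ fun n ω => |1 / (n : ℝ) * ∑ i ∈ Finset.range n, logNoise p (R i ω) ^ 2 -
      3 / (2 * p ^ 2)| ≤ √(Real.log n / (n * h n)) := by
  have hprobR := hS.isProbabilityMeasure_PR
  have hm := measurable_logNoise p
  set W : ℕ → Ω → ℝ := fun i ω => logNoise p (R i ω) ^ 2 with hW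
  have hWm : ∀ i, Measurable (W i) := fun i => (hm.comp (hS.measurable_R i)).pow_const 2
  have hWL : ∀ i, MemLp (W i) 2 μ := fun i => by
    rw [memLp_two_iff_integrable_sq (hWm i).aestronglyMeasurable]
    have h4 : Integrable (fun r => (logNoise p r ^ 2) ^ 2) (matsuoka p) :=
      (integrable_abs_logNoise_pow hp 4).congr (ae_of_all _ fun r => by
        simp only
        rw [← sq_abs (logNoise p r)]; ring)
    rw [← hS.law_R i] at h4
    exact h4.comp_measurable (hS.measurable_R i)
  have hmean : ∀ i, ∫ ω, W i ω ∂μ = 3 / (2 * p ^ 2) := fun i => by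
    have := integral_map (μ := μ) (hS.measurable_R i).aemeasurable
      (f := fun r => logNoise p r ^ 2) (hm.pow_const 2).aestronglyMeasurable
    rw [hS.law_R i, integral_logNoise_sq hp] at this
    exact this.symm
  have hind : iIndepFun W μ :=
    hS.indep_units.comp (fun _ q => logNoise p q.2 ^ 2) fun _ => by fun_prop
  set V := ∫ r, (logNoise p r ^ 2) ^ 2 ∂(matsuoka p)
  have hvar : ∀ i, variance (W i) μ ≤ V := fun i => by
    refine (variance_le_expectation_sq (hWm i).aestronglyMeasurable).trans (le_of_eq ?_)
    have := integral_map (μ := μ) (hS.measurable_R i).aemeasurable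
      (f := fun r => (logNoise p r ^ 2) ^ 2) ((hm.pow_const 2).pow_const 2).aestronglyMeasurable
    rw [hS.law_R i] at this
    exact this.symm
  have hV : 0 ≤ V := integral_nonneg fun r => by positivity
  -- Chebyshev at level r = √(ln n/(nh)) gives nV/(nr)² = V h/ln n ≤ V h, which tends to zero.
  refine .of_measureReal (fun n => V * h n) (by simpa using hh.tendsto.const_mul V) ?_
  filter_upwards [eventually_gt_atTop 0, eventually_one_le_log] with n hn hlog
  have hn0 : (0 : ℝ) < n := by exact_mod_cast hn
  have hpos := hh.pos n
  set r := √(Real.log n / (n * h n))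
  have hr2 : r ^ 2 = Real.log n / (n * h n) := Real.sq_sqrt (by positivity)
  have hr : 0 < r := Real.sqrt_pos.2 (by positivity)
  have hsumL : MemLp (∑ i ∈ Finset.range n, W i) 2 μ := memLp_finsetSum' _ fun i _ => hWL i
  have hch := meas_ge_le_variance_div_sq hsumL (mul_pos hn0 hr)
  have hvs : variance (∑ i ∈ Finset.range n, W i) μ ≤ n * V := by
    rw [IndepFun.variance_sum (fun i _ => hWL i) fun i _ j _ hij => hind.indepFun hij]
    refine (Finset.sum_le_sum fun i _ => hvar i).trans ?_
    simp
  have hE : ∫ ω, (∑ i ∈ Finset.range n, W i) ω ∂μ = n * (3 / (2 * p ^ 2)) := by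
    simp only [Finset.sum_apply]
    rw [integral_finsetSum _ fun i _ => (hWL i).integrable (by norm_num)]
    simp [hmean]
  rw [hE] at hch
  have hle : variance (∑ i ∈ Finset.range n, W i) μ / (n * r) ^ 2 ≤ V * h n := by
    rw [div_le_iff₀ (by positivity), mul_pow, hr2]
    refine hvs.trans ?_
    have : V * h n * (n ^ 2 * (Real.log n / (n * h n))) = n * V * Real.log n := by field_simp
    rw [this]
    exact le_mul_of_one_le_right (by positivity) hlog
  refine le_trans (measureReal_mono (fun ω hω => ?_) (measure_ne_top _ _)) (le_trans
    (ENNReal.toReal_mono ENNReal.ofReal_ne_top (hch.trans (ENNReal.ofReal_le_ofReal hle))) (le_of_eq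
      (ENNReal.toReal_ofReal (by positivity))))
  rw [Set.mem_ofPred_eq, not_le] at hω
  rw [Set.mem_ofPred_eq, Finset.sum_apply]
  have e : ∑ i ∈ Finset.range n, W i ω - n * (3 / (2 * p ^ 2)) =
      n * (1 / (n : ℝ) * ∑ i ∈ Finset.range n, logNoise p (R i ω) ^ 2 - 3 / (2 * p ^ 2)) := by
    simp only [hW]
    field_simp
  rw [e, abs_mul, abs_of_pos hn0]
  exact (mul_lt_mul_of_pos_left hω hn0).le

theorem pHat_uniform [IsProbabilityMeasure μ] (hp : 0 < p)
    (hf : ∀ x ∈ Set.Icc a b, 0 < f x) (hs : IsFrontierSample μ p f fX X R Y)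
    (hZ : ∀ i ω, Z i ω = -Real.log (Y i ω)) (hA1 : AssumptionA1 a b fX)
    (hh : AssumptionA5 h) {M : ℝ} (hM : 0 < M)
    (hg : WithHighProb μ fun n ω => ∀ z ∈ Set.Icc a b,
      |localLinear K (h n) (firstObs X n ω) (firstObs Z n ω) z - regression p f z| ≤
        M * Frontier.rate h n) :
    ∃ N, 0 < N ∧ WithHighProb μ fun n ω =>
      |pHat K (h n) (firstObs X n ω) (firstObs Z n ω) - p| ≤ N * Frontier.rate h n := by
  have hS := hs.isProductSample
  -- With ρ the rate, eventually at most 1: the mean square error is at most 3/(2p²) + 1, the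
  -- squared perturbation (Mρ)² is at most M²ρ, and the last 1 is the Chebyshev deviation.
  set A := (1 + (3 / (2 * p ^ 2) + 1)) * M + M ^ 2 + 1
  have hA : 0 < A := by positivity
  refine ⟨4 / 3 * p ^ 3 * A, by positivity,
    ((hg.and (hS.withHighProb_mean_sq hp hh)).and (.of_ae (hs.ae_log_model hf hZ hA1))).mono ?_⟩
  have hsmall : ∀ᶠ n in atTop, A * Frontier.rate h n ≤ 3 / (4 * p ^ 2) := by
    have := hh.tendsto_rate.const_mul A
    rw [mul_zero] at this
    exact this.eventually_le_const (by positivity)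
  filter_upwards [hsmall, hh.tendsto_rate.eventually_le_const one_pos, eventually_gt_atTop 0]
    with n hsm hρ1 hn ω hω
  obtain ⟨⟨hgn, hsq⟩, hmodel⟩ := hω
  have hn0 : (0 : ℝ) < n := by exact_mod_cast hn
  have hρ := rate_nonneg h n
  have hrρ := sqrt_le_rate h n
  set ρ := Frontier.rate h n
  set y := localLinear K (h n) (firstObs X n ω) (firstObs Z n ω)
  have hmean := abs_mean_sq_sub_le hn (e := fun i => logNoise p (R i ω))
    (d := fun i => regression p f (X i ω) - y (X i ω)) (δ := M * ρ) fun i => by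
      rw [abs_sub_comm]
      exact hgn _ (hmodel i).1
  have hres : ∀ i, logNoise p (R i ω) + (regression p f (X i ω) - y (X i ω)) = Z i ω - y (X i ω) :=
    fun i => by rw [(hmodel i).2]; ring
  simp only [hres] at hmean
  set s₀ := 1 / (n : ℝ) * ∑ i ∈ Finset.range n, logNoise p (R i ω) ^ 2
  set s := 1 / (n : ℝ) * ∑ i ∈ Finset.range n, (Z i ω - y (X i ω)) ^ 2 with hsdef
  have hs₀ : s₀ ≤ 3 / (2 * p ^ 2) + 1 := by linarith [(abs_le.1 hsq).2]
  have hclose : |s - 3 / (2 * p ^ 2)| ≤ A * ρ := by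
    have h1 : (1 + s₀) * (M * ρ) ≤ (1 + (3 / (2 * p ^ 2) + 1)) * (M * ρ) := by gcongr
    have h2 : (M * ρ) ^ 2 ≤ M ^ 2 * ρ := by
      rw [mul_pow]
      gcongr
      nlinarith
    have h3 := abs_sub_le s s₀ (3 / (2 * p ^ 2))
    simp only [A]
    linarith
  have hpHat : pHat K (h n) (firstObs X n ω) (firstObs Z n ω) = √(3 / (2 * s)) := by
    rw [pHat, hsdef]
    simp only [firstObs]
    rw [Fin.sum_univ_eq_sum_range (fun i => (Z i ω - y (X i ω)) ^ 2) n]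
    congr 1
    field_simp
  rw [hpHat, mul_assoc]
  exact abs_sqrt_inv_sub_le hp hclose hsm

/-- Both f and its estimator are exponentials. The exponents differ by at most A times the rate and
the true one is at most 3/(2p) + G, where exp is Lipschitz on the relevant range. -/
theorem fHat_uniform (hp : 0 < p) (hf : ∀ x ∈ Set.Icc a b, 0 < f x)
    (hA1 : AssumptionA1 a b fX) (hA4 : AssumptionA4 a b fX (regression p f))
    (hh : AssumptionA5 h) {M N : ℝ} (hM : 0 < M) (hN : 0 < N)
    (hg : WithHighProb μ fun n ω => ∀ z ∈ Set.Icc a b,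
      |localLinear K (h n) (firstObs X n ω) (firstObs Z n ω) z - regression p f z| ≤
        M * Frontier.rate h n)
    (hpHat : WithHighProb μ fun n ω =>
      |pHat K (h n) (firstObs X n ω) (firstObs Z n ω) - p| ≤ N * Frontier.rate h n) :
    ∃ B, 0 < B ∧ WithHighProb μ fun n ω => ∀ x ∈ Set.Icc a b,
      |fHat K (h n) (firstObs X n ω) (firstObs Z n ω) x - f x| ≤ B * Frontier.rate h n := by
  obtain ⟨G, hG0, hG⟩ := exists_taylor_quotient hA4.density hA4.product hA1.lower
  set A := 3 / p ^ 2 * N + M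
  have hA : 0 < A := by positivity
  refine ⟨2 * Real.exp (3 / (2 * p) + G) * A, by positivity, (hg.and hpHat).mono ?_⟩
  have h1 : ∀ᶠ n in atTop, A * Frontier.rate h n ≤ 1 := by
    have := hh.tendsto_rate.const_mul A
    rw [mul_zero] at this
    exact this.eventually_le_const one_pos
  have h2 : ∀ᶠ n in atTop, N * Frontier.rate h n ≤ p / 2 := by
    have := hh.tendsto_rate.const_mul N
    rw [mul_zero] at this
    exact this.eventually_le_const (by positivity)
  filter_upwards [h1, h2] with n hn1 hn2 ω hω x hx
  have hgx := hω.1 x hx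
  have hpx := abs_div_sub_div_le hp hω.2 hn2
  have hfx : f x = Real.exp (3 / (2 * p) - regression p f x) := by
    rw [regression, sub_sub_cancel, Real.exp_log (hf x hx)]
  rw [hfx, fHat, mul_assoc]
  refine abs_exp_sub_exp_le ?_ ?_ hn1
  · linarith [(abs_le.1 (hG x hx).1).1]
  · rw [sub_sub_sub_comm]
    refine (abs_sub _ _).trans ((add_le_add hpx hgx).trans (le_of_eq ?_))
    simp only [A]
    ring

end
end Frontier

theorem theorem3 {Ω : Type*} [MeasurableSpace Ω] (μ : Measure Ω) [IsProbabilityMeasure μ]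
    (p a b : ℝ) (f fX K : ℝ → ℝ) (h : ℕ → ℝ) (X R Y Z : ℕ → Ω → ℝ)
    (hp : 0 < p) (hf : ∀ x ∈ Set.Icc a b, 0 < f x)
    (hsample : Frontier.IsFrontierSample μ p f fX X R Y)
    (hZ : ∀ i ω, Z i ω = -Real.log (Y i ω))
    (hA1 : Frontier.AssumptionA1 a b fX)
    (hA2 : Frontier.AssumptionA2 K) (hK : Frontier.KernelNondegenerate K)
    (hA3 : Frontier.AssumptionA3 μ fX (X 0) (Z 0))
    (hA4 : Frontier.AssumptionA4 a b fX (Frontier.regression p f))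
    (hA5 : Frontier.AssumptionA5 h) :
    Frontier.IsBigOp μ
      (fun n ω => ENNReal.ofReal
        |Frontier.pHat K (h n) (Frontier.firstObs X n ω) (Frontier.firstObs Z n ω) - p|)
      (Frontier.rate h) ∧
    Frontier.IsBigOp μ
      (fun n ω => ⨆ x ∈ Set.Icc a b, ENNReal.ofReal
        |Frontier.fHat K (h n) (Frontier.firstObs X n ω) (Frontier.firstObs Z n ω) x - f x|)
      (Frontier.rate h) := by
  obtain ⟨M, hM, hg⟩ := Frontier.localLinear_uniform hp hf hsample hZ hA1 hA2 hK hA4 hA5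
  obtain ⟨N, hN, hpHat⟩ := Frontier.pHat_uniform hp hf hsample hZ hA1 hA5 hM hg
  obtain ⟨B, hB, hfHat⟩ := Frontier.fHat_uniform hp hf hA1 hA4 hA5 hM hN hg hpHat
  refine ⟨Frontier.WithHighProb.isBigOp hN (hpHat.mono (Eventually.of_forall fun n ω hω => ?_)),
    Frontier.WithHighProb.isBigOp hB (hfHat.mono (Eventually.of_forall fun n ω hω => ?_))⟩
  · exact ENNReal.ofReal_le_ofReal hω
  -- The event bounds all x simultaneously, so the supremum in the extended half-line inherits the
  -- bound directly.
  · exact iSup₂_le fun x hx => ENNReal.ofReal_le_ofReal (hω x hx)
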